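/- Work with monadic second-order (MSO) formulas in the language of order, interpreted in a chain (linearly ordered set) $C$, the set variables ranging over all subsets of $C$; parameters are finite tuples $\bar P$ of subsets of $C$. $C$ has the *uniformization property* if for every MSO formula $\varphi(X,Y,\bar P)$ with parameters $\bar P$ from $C$ such that $C\models\forall Y\,\exists X\,\varphi(X,Y,\bar P)$ there is an MSO formula $\psi(X,Y,\bar Q)$ with parameters $\bar Q$ from $C$ such that $C\models\forall Y\,\exists! X\,\psi(X,Y,\bar Q)$ and $C\models\forall X\,\forall Y\,(\psi(X,Y,\bar Q)\to\varphi(X,Y,\bar P))$. $C$ is *tame* if it is scattered (the rational order does not embed in it) and has finite Hausdorff degree, where degree $\le 0$ means that $C$ is finite, and degree $\le n+1$ means that $C=\sum_{i\in I}C_i$ with $I$ well ordered or inversely well ordered and every $C_i$ of degree $\le n$. For a nonempty tame chain $C$ put $\mathrm{Log}(C)=\infty$ if some formula $\varphi(x,y,\bar P)$ with parameters from $C$ defines a well-ordering of the elements of $C$ of order type $\ge\omega^\omega$, and $\mathrm{Log}(C)=k$ ($k<\omega$) if some formula $\varphi(x,y,\bar P)$ with parameters from $C$ defines a well-ordering of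 the elements of $C$ of order type $\alpha$ with $\omega^k\le\alpha<\omega^{k+1}$. **Theorem.** If a nonempty tame chain $C$ has the uniformization property, then $\mathrm{Log}(C)<\omega$: exactly one value in $\omega\cup\{\infty\}$ satisfies the definition of $\mathrm{Log}(C)$, and it is finite. In particular $C$ admits no definable well-ordering of order type $\ge\omega^\omega$. -/

import Mathlib

universe u

/-- Formulas of the monadic second-order language of order with (at most) the free variables
`X₀, …, X_{n-1}`.  All variables are set variables; an individual variable `x` is represented by a
set variable `X` with `sing X` (then `x ∈ Y` is `X ⊆ Y`, and `x = y` is `X ⊆ Y ∧ Y ⊆ X`).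
The quantifier binds the last variable `X_n`. -/
inductive MSOFormula : ℕ → Type
  /-- `X_i ⊆ X_j` -/
  | sub {n : ℕ} (i j : Fin n) : MSOFormula n
  /-- `X_i` is a singleton -/
  | sing {n : ℕ} (i : Fin n) : MSOFormula n
  /-- `X_i = {x}` and `X_j = {y}` with `x < y` -/
  | lt {n : ℕ} (i j : Fin n) : MSOFormula n
  | neg {n : ℕ} (φ : MSOFormula n) : MSOFormula n
  | and {n : ℕ} (φ ψ : MSOFormula n) : MSOFormula n
  /-- `∃ X_n, φ` -/
  | ex {n : ℕ} (φ : MSOFormula (n + 1)) : MSOFormula n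

namespace MSOFormula

/-- Satisfaction `C ⊨ φ(A₀, …, A_{n-1})` in the chain `C`; set variables range over all subsets. -/
def Holds {C : Type u} [LinearOrder C] : {n : ℕ} → MSOFormula n → (Fin n → Set C) → Prop
  | _, sub i j, A => A i ⊆ A j
  | _, sing i, A => ∃ x, A i = {x}
  | _, lt i j, A => ∃ x y, A i = {x} ∧ A j = {y} ∧ x < y
  | _, neg φ, A => ¬ φ.Holds A
  | _, and φ ψ, A => φ.Holds A ∧ ψ.Holds A
  | _, ex φ, A => ∃ B : Set C, φ.Holds (Fin.snoc A B : Fin (_ + 1) → Set C)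

/-- `C ⊨ φ(X, Y, P₀, …, P_{m-1})`. -/
def HoldsAt {C : Type u} [LinearOrder C] {m : ℕ} (φ : MSOFormula (m + 2))
    (P : Fin m → Set C) (X Y : Set C) : Prop :=
  φ.Holds (Fin.cons X (Fin.cons Y P : Fin (m + 1) → Set C) : Fin (m + 2) → Set C)

/-- The binary relation `C ⊨ φ(x, y, P₀, …, P_{m-1})` on the elements of `C`. -/
def Rel {C : Type u} [LinearOrder C] {m : ℕ} (φ : MSOFormula (m + 2))
    (P : Fin m → Set C) (x y : C) : Prop :=
  φ.HoldsAt P {x} {y}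

end MSOFormula

/-- Every formula `φ(X, Y, P̄)` with parameters `P̄` from `C` such that `C ⊨ ∀ Y ∃ X φ(X, Y, P̄)` is
uniformized by some formula `ψ(X, Y, Q̄)` with parameters `Q̄` from `C`. -/
def HasUniformizationProperty (C : Type u) [LinearOrder C] : Prop :=
  ∀ (m : ℕ) (φ : MSOFormula (m + 2)) (P : Fin m → Set C),
    (∀ Y : Set C, ∃ X : Set C, φ.HoldsAt P X Y) →
    ∃ (k : ℕ) (ψ : MSOFormula (k + 2)) (Q : Fin k → Set C),
      (∀ Y : Set C, ∃! X : Set C, ψ.HoldsAt Q X Y) ∧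
      ∀ X Y : Set C, ψ.HoldsAt Q X Y → φ.HoldsAt P X Y

/-- A chain is scattered if the rationals do not embed in it. -/
def IsScatteredChain (C : Type u) [LinearOrder C] : Prop :=
  IsEmpty (ℚ ↪o C)

/-- The Hausdorff degree of `C` is at most `n`.  Degree `0` means finite; degree at most `n + 1`
means that `C` is a sum `∑_{i ∈ I} C_i` of chains of degree at most `n` over a chain `I` that is
well ordered or inversely well ordered.  (A presentation of `C` as such a sum is a monotone map
`f : C → I`, the summands being the fibres.) -/
def HausdorffDegreeLE : ℕ → ∀ (C : Type u) [LinearOrder C], Prop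
  | 0, C, _ => Finite C
  | n + 1, C, _ => ∃ (I : Type u) (_ : LinearOrder I), (WellFoundedLT I ∨ WellFoundedGT I) ∧
      ∃ f : C → I, Monotone f ∧ ∀ i : I, HausdorffDegreeLE n {c : C // f c = i}

/-- A chain is tame if it is scattered of finite Hausdorff degree. -/
def IsTameChain (C : Type u) [LinearOrder C] : Prop :=
  IsScatteredChain C ∧ ∃ n : ℕ, HausdorffDegreeLE n C

/-- Some formula `φ(x, y, P̄)` with parameters `P̄` from `C` defines a (strict) well-ordering of order
type `α` on the elements of `C`. -/
def HasDefinableWellOrder (C : Type u) [LinearOrder C] (α : Ordinal.{u}) : Prop :=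
  ∃ (m : ℕ) (φ : MSOFormula (m + 2)) (P : Fin m → Set C) (_ : IsWellOrder C (φ.Rel P)),
    Ordinal.type (φ.Rel P) = α

/-- `Log(C) = l`: for `l = ∞` there is a definable well-ordering of order type at least `ω ^ ω`; for
`l = k` finite there is one of order type `α` with `ω ^ k ≤ α < ω ^ (k + 1)`. -/
def IsLog (C : Type u) [LinearOrder C] (l : ℕ∞) : Prop :=
  (l = ⊤ ∧ ∃ α : Ordinal.{u}, HasDefinableWellOrder C α ∧
    Ordinal.omega0 ^ Ordinal.omega0 ≤ α) ∨
  ∃ k : ℕ, l = (k : ℕ∞) ∧ ∃ α : Ordinal.{u}, HasDefinableWellOrder C α ∧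
    Ordinal.omega0 ^ k ≤ α ∧ α < Ordinal.omega0 ^ (k + 1)

/-! Write `R` for one particular definable well-ordering of the chain. The theorem follows from
three facts.

Construction (`exists_layered_isWellOrder`). By induction on the Hausdorff degree `n`, finitely many
sets code a well-ordering `R`: the summands are ordered recursively, and follow one another forwards
or backwards according to the index chain. Its size is controlled: if `R` has type at least `ω ^ (n
* k + 1)`, then `C` contains a copy of `ω ^ k` or of its reverse.

Uniformization (`HasUniformizationProperty.exists_not_large`). Suppose `C` contains `ω ^ n` for
every `n`. Then no formula selects ladders, that is, cofinal subsets without limits inside the given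
set. By Ramsey's theorem and the composition theorem there is a copy of some `ω ^ (l + 1)` on which
blocks of lengths `ω ^ j` and `ω ^ l`, `j < l`, have the same type of a given depth. Replacing one
block of length `ω ^ l` between consecutive ladder points by one of length `ω ^ j` yields another
set of the same type, so the selection is not unique. Applied to `C` and its dual, this bounds the
`k` above. Hence `R` has type below some finite power of `ω`, and `C` is countable.

Uniqueness (`large_univ_of_definable`). In a countable scattered chain all definable well-orderings
reach the same finite powers of `ω`. By induction on scattered chains it suffices to pass to
`ω`-sums and `ω*`-sums. There, Ramsey's theorem gives a finite colouring such that each of the two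
orderings increases from block to block on every colour that recurs forever; otherwise it would fail
to have least elements. -/

/-! ### Monadic types and the composition theorem -/

/-- The monadic types of depth `d` of an `m`-tuple of subsets of a chain. -/
def MSOType : ℕ → ℕ → Type
  | 0, m => (Fin m → Fin m → Prop) × (Fin m → Prop) × (Fin m → Prop) × (Fin m → Fin m → Prop)
  | d + 1, m => Set (MSOType d (m + 1))

instance MSOType.instFinite : ∀ d m : ℕ, Finite (MSOType d m)
  | 0, m => by unfold MSOType; infer_instance
  | d + 1, m => by
    have := MSOType.instFinite d (m + 1)
    unfold MSOType; infer_instance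

/-- The monadic type of depth `d` of the tuple `A` in the subchain `S`. -/
def mtype {C : Type u} [LinearOrder C] : (d : ℕ) → {m : ℕ} → Set C → (Fin m → Set C) → MSOType d m
  | 0, _, S, A => (fun i j => A i ∩ S ⊆ A j, fun i => A i ∩ S = ∅, fun i => (A i ∩ S).Subsingleton,
      fun i j => ∀ x ∈ A i ∩ S, ∀ y ∈ A j ∩ S, x < y)
  | d + 1, _, S, A => Set.range fun B : Set C =>
      mtype d S (Fin.snoc A B : Fin (_ + 1) → Set C)

section Types

variable {C D : Type u} [LinearOrder C] [LinearOrder D]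

/-- The back-and-forth condition of the Ehrenfeucht–Fraïssé game, obtained by unfolding equality of
two ranges. -/
theorem mtype_succ_eq_iff {d m : ℕ} {S : Set C} {T : Set D} {A : Fin m → Set C}
    {B : Fin m → Set D} : mtype (d + 1) S A = mtype (d + 1) T B ↔
      (∀ X : Set C, ∃ Z : Set D, mtype d S (Fin.snoc A X : Fin (m + 1) → Set C) =
        mtype d T (Fin.snoc B Z : Fin (m + 1) → Set D)) ∧
      ∀ Z : Set D, ∃ X : Set C, mtype d S (Fin.snoc A X : Fin (m + 1) → Set C) =
        mtype d T (Fin.snoc B Z : Fin (m + 1) → Set D) := by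
  have h : mtype (d + 1) S A = mtype (d + 1) T B ↔
      (Set.range fun X : Set C => mtype d S (Fin.snoc A X : Fin (m + 1) → Set C)) =
        Set.range fun Z : Set D => mtype d T (Fin.snoc B Z : Fin (m + 1) → Set D) := Iff.rfl
  rw [h, Set.Subset.antisymm_iff, Set.range_subset_iff, Set.range_subset_iff]
  simp only [Set.mem_range, eq_comm]

theorem mtype_congr (d : ℕ) {m : ℕ} {S : Set C} {A B : Fin m → Set C}
    (h : ∀ i, A i ∩ S = B i ∩ S) : mtype d S A = mtype d S B := by
  induction d generalizing m with
  | zero =>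
    have h' : ∀ F : Fin m → Set C, ∀ X j, (X ∩ S ⊆ F j) ↔ (X ∩ S ⊆ F j ∩ S) := fun F X j =>
      ⟨fun k => Set.subset_inter k Set.inter_subset_right, fun k => k.trans Set.inter_subset_left⟩
    refine Prod.ext ?_ (Prod.ext ?_ (Prod.ext ?_ ?_))
    · funext i j
      simp only [mtype]
      rw [h' A, h' B, h, h]
    all_goals simp only [mtype, h]
  | succ d ih =>
    simp only [mtype]
    congr 1
    funext X
    apply ih
    intro i
    refine Fin.lastCases ?_ (fun i => ?_) i
    · simp
    · simpa using h i

/-- The composition theorem: the type of an ordered sum is determined by the types of the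
summands. -/
theorem mtype_iUnion {I : Type*} [LinearOrder I] (d : ℕ) {m : ℕ} {S : I → Set C} {T : I → Set D}
    {A : Fin m → Set C} {B : Fin m → Set D}
    (hS : ∀ i j, i < j → ∀ x ∈ S i, ∀ y ∈ S j, x < y)
    (hT : ∀ i j, i < j → ∀ x ∈ T i, ∀ y ∈ T j, x < y)
    (h : ∀ i, mtype d (S i) A = mtype d (T i) B) :
    mtype d (⋃ i, S i) A = mtype d (⋃ i, T i) B := by
  induction d generalizing m with
  | zero =>
    -- The depth 0 data of a sum is computed from the data of its summands. Being a singleton is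
    -- split into non-emptiness and having at most one element, since both parts can be read off
    -- summand by summand.
    have key : ∀ {E : Type u} [LinearOrder E] (U : I → Set E) (F : Fin m → Set E),
        (∀ i j, i < j → ∀ x ∈ U i, ∀ y ∈ U j, x < y) →
        mtype 0 (⋃ i, U i) F =
          ((fun i j => ∀ p, F i ∩ U p ⊆ F j), (fun i => ∀ p, F i ∩ U p = ∅),
          (fun i => ∀ p, (F i ∩ U p).Subsingleton ∧ ∀ q, p ≠ q → F i ∩ U p = ∅ ∨ F i ∩ U q = ∅),
          (fun i j => ∀ p, (∀ x ∈ F i ∩ U p, ∀ y ∈ F j ∩ U p, x < y) ∧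
            ∀ q, q < p → F i ∩ U p = ∅ ∨ F j ∩ U q = ∅)) := by
      intro E _ U F hU
      have hd : ∀ p q x, x ∈ U p → x ∈ U q → p = q := by
        intro p q x hp hq
        rcases lt_trichotomy p q with hlt | rfl | hlt
        · exact absurd (hU _ _ hlt _ hp _ hq) (lt_irrefl _)
        · rfl
        · exact absurd (hU _ _ hlt _ hq _ hp) (lt_irrefl _)
      simp only [mtype]
      refine Prod.ext ?_ (Prod.ext ?_ (Prod.ext ?_ ?_))
      · funext i j
        simp only [Set.inter_iUnion, Set.iUnion_subset_iff]
      · funext i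
        simp only [Set.inter_iUnion, Set.iUnion_eq_empty]
      · funext i
        apply propext
        constructor
        · intro hs p
          refine ⟨fun x hx y hy => hs ⟨hx.1, Set.mem_iUnion.2 ⟨p, hx.2⟩⟩
            ⟨hy.1, Set.mem_iUnion.2 ⟨p, hy.2⟩⟩, fun q hpq => ?_⟩
          by_contra! hne
          obtain ⟨⟨x, hx⟩, ⟨y, hy⟩⟩ := hne
          have := hs ⟨hx.1, Set.mem_iUnion.2 ⟨p, hx.2⟩⟩ ⟨hy.1, Set.mem_iUnion.2 ⟨q, hy.2⟩⟩
          subst this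
          exact hpq (hd _ _ _ hx.2 hy.2)
        · rintro hs x ⟨hx, hx'⟩ y ⟨hy, hy'⟩
          obtain ⟨p, hp⟩ := Set.mem_iUnion.1 hx'
          obtain ⟨q, hq⟩ := Set.mem_iUnion.1 hy'
          by_cases hpq : p = q
          · subst hpq; exact (hs p).1 ⟨hx, hp⟩ ⟨hy, hq⟩
          · rcases (hs p).2 q hpq with h0 | h0
            · exact absurd (h0 ▸ ⟨hx, hp⟩ : x ∈ (∅ : Set E)) (Set.notMem_empty _)
            · exact absurd (h0 ▸ ⟨hy, hq⟩ : y ∈ (∅ : Set E)) (Set.notMem_empty _)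
      · funext i j
        apply propext
        constructor
        · intro hs p
          refine ⟨fun x hx y hy => hs x ⟨hx.1, Set.mem_iUnion.2 ⟨p, hx.2⟩⟩
            y ⟨hy.1, Set.mem_iUnion.2 ⟨p, hy.2⟩⟩, fun q hpq => ?_⟩
          by_contra! hne
          obtain ⟨⟨x, hx⟩, ⟨y, hy⟩⟩ := hne
          have := hs x ⟨hx.1, Set.mem_iUnion.2 ⟨p, hx.2⟩⟩ y ⟨hy.1, Set.mem_iUnion.2 ⟨q, hy.2⟩⟩
          exact lt_asymm this (hU _ _ hpq _ hy.2 _ hx.2)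
        · rintro hs x ⟨hx, hx'⟩ y ⟨hy, hy'⟩
          obtain ⟨p, hp⟩ := Set.mem_iUnion.1 hx'
          obtain ⟨q, hq⟩ := Set.mem_iUnion.1 hy'
          rcases lt_trichotomy p q with hlt | rfl | hlt
          · exact hU _ _ hlt _ hp _ hq
          · exact (hs p).1 x ⟨hx, hp⟩ y ⟨hy, hq⟩
          · rcases (hs p).2 q hlt with h0 | h0
            · exact absurd (h0 ▸ ⟨hx, hp⟩ : x ∈ (∅ : Set E)) (Set.notMem_empty _)
            · exact absurd (h0 ▸ ⟨hy, hq⟩ : y ∈ (∅ : Set E)) (Set.notMem_empty _)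
    rw [key S A hS, key T B hT]
    have h1 : ∀ p i j, (A i ∩ S p ⊆ A j) = (B i ∩ T p ⊆ B j) := fun p i j =>
      congrFun (congrFun (congrArg Prod.fst (h p)) i) j
    have h2 : ∀ p i, (A i ∩ S p = ∅) = (B i ∩ T p = ∅) := fun p i =>
      congrFun (congrArg (fun t => t.2.1) (h p)) i
    have h3 : ∀ p i, (A i ∩ S p).Subsingleton = (B i ∩ T p).Subsingleton := fun p i =>
      congrFun (congrArg (fun t => t.2.2.1) (h p)) i
    have h4 : ∀ p i j, (∀ x ∈ A i ∩ S p, ∀ y ∈ A j ∩ S p, x < y) =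
        (∀ x ∈ B i ∩ T p, ∀ y ∈ B j ∩ T p, x < y) := fun p i j =>
      congrFun (congrFun (congrArg (fun t => t.2.2.2) (h p)) i) j
    simp only [h1, h2, h3, h4]
    rfl
  | succ d ih =>
    -- Responses chosen separately in each summand are glued; as the summands are disjoint, the
    -- glued set has the chosen trace on each of them.
    have key : ∀ {E : Type u} [LinearOrder E] (V : I → Set E) (L : Fin m → Set E) (Z : I → Set E),
        (∀ i j, i < j → ∀ x ∈ V i, ∀ y ∈ V j, x < y) → ∀ i,
        mtype d (V i) (Fin.snoc L (⋃ i, Z i ∩ V i) : Fin (m + 1) → Set E) =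
          mtype d (V i) (Fin.snoc L (Z i) : Fin (m + 1) → Set E) := by
      intro E _ V L Z hV i
      apply mtype_congr
      intro k
      refine Fin.lastCases ?_ (fun k => ?_) k
      · simp only [Fin.snoc_last]
        ext z
        simp only [Set.mem_inter_iff, Set.mem_iUnion]
        constructor
        · rintro ⟨⟨j, h1, h2⟩, h3⟩
          rcases lt_trichotomy i j with hlt | rfl | hlt
          · exact absurd (hV _ _ hlt _ h3 _ h2) (lt_irrefl _)
          · exact ⟨h1, h3⟩
          · exact absurd (hV _ _ hlt _ h2 _ h3) (lt_irrefl _)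
        · rintro ⟨h1, h2⟩
          exact ⟨⟨i, h1, h2⟩, h2⟩
      · simp
    rw [mtype_succ_eq_iff]
    constructor
    · intro X
      choose Z hZ using fun i => (mtype_succ_eq_iff.1 (h i)).1 X
      exact ⟨⋃ i, Z i ∩ T i, ih fun i => (hZ i).trans (key T B Z hT i).symm⟩
    · intro Z
      choose X hX using fun i => (mtype_succ_eq_iff.1 (h i)).2 Z
      exact ⟨⋃ i, X i ∩ S i, ih fun i => (key S A X hS i).trans (hX i)⟩

/-- Induction on the formula, each quantifier costing one level of depth. The claim covers all
larger depths because a conjunction needs a depth that serves both conjuncts. -/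
theorem MSOFormula.exists_depth {n : ℕ} (φ : MSOFormula n) : ∃ d₀ : ℕ, ∀ d, d₀ ≤ d →
    ∀ A B : Fin n → Set C, mtype d Set.univ A = mtype d Set.univ B → (φ.Holds A ↔ φ.Holds B) := by
  have atoms : ∀ {n : ℕ} (d : ℕ) (A B : Fin n → Set C), mtype d Set.univ A = mtype d Set.univ B →
      mtype 0 Set.univ A = mtype 0 Set.univ B := by
    intro n d A B h
    induction d generalizing n with
    | zero => exact h
    | succ d ih =>
      obtain ⟨X, hX⟩ := (mtype_succ_eq_iff.1 h).1 ∅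
      have h0 := ih _ _ hX
      refine Prod.ext ?_ (Prod.ext ?_ (Prod.ext ?_ ?_))
      · funext i j
        simpa [mtype] using
          (congrFun (congrFun (congrArg Prod.fst h0) i.castSucc) j.castSucc)
      · funext i
        simpa [mtype] using (congrFun (congrArg (fun t => t.2.1) h0) i.castSucc)
      · funext i
        simpa [mtype] using (congrFun (congrArg (fun t => t.2.2.1) h0) i.castSucc)
      · funext i j
        simpa [mtype] using
          (congrFun (congrFun (congrArg (fun t => t.2.2.2) h0) i.castSucc) j.castSucc)
  have single : ∀ (X : Set C), (∃ x, X = {x}) ↔ X.Subsingleton ∧ ¬ X = ∅ := by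
    intro X
    constructor
    · rintro ⟨x, rfl⟩
      simp
    · rintro ⟨h1, h2⟩
      obtain ⟨x, hx⟩ := Set.nonempty_iff_ne_empty.2 h2
      exact ⟨x, h1.eq_singleton_of_mem hx⟩
  induction φ with
  | sub i j =>
    refine ⟨0, fun d _ A B h => ?_⟩
    have := congrFun (congrFun (congrArg Prod.fst (atoms d A B h)) i) j
    simpa [mtype, MSOFormula.Holds] using this
  | sing i =>
    refine ⟨0, fun d _ A B h => ?_⟩
    have h1 := congrFun (congrArg (fun t => t.2.1) (atoms d A B h)) i
    have h2 := congrFun (congrArg (fun t => t.2.2.1) (atoms d A B h)) i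
    simp only [mtype, Set.inter_univ] at h1 h2
    simp only [MSOFormula.Holds, single, h1, h2]
  | lt i j =>
    refine ⟨0, fun d _ A B h => ?_⟩
    have h1 := congrArg (fun t => t.2.1) (atoms d A B h)
    have h2 := congrArg (fun t => t.2.2.1) (atoms d A B h)
    have h3 := congrFun (congrFun (congrArg (fun t => t.2.2.2) (atoms d A B h)) i) j
    simp only [mtype, Set.inter_univ, funext_iff] at h1 h2 h3
    have hl : ∀ X Y : Set C, (∃ x y, X = {x} ∧ Y = {y} ∧ x < y) ↔
        (∃ x, X = {x}) ∧ (∃ y, Y = {y}) ∧ ∀ x ∈ X, ∀ y ∈ Y, x < y := by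
      intro X Y
      constructor
      · rintro ⟨x, y, rfl, rfl, hxy⟩
        simpa using hxy
      · rintro ⟨⟨x, rfl⟩, ⟨y, rfl⟩, hxy⟩
        exact ⟨x, y, rfl, rfl, hxy x rfl y rfl⟩
    simp only [MSOFormula.Holds, hl, single, h1, h2, h3]
  | neg φ ih =>
    obtain ⟨d₀, h₀⟩ := ih
    exact ⟨d₀, fun d hd A B h => not_congr (h₀ d hd A B h)⟩
  | and φ ψ ih₁ ih₂ =>
    obtain ⟨d₁, h₁⟩ := ih₁
    obtain ⟨d₂, h₂⟩ := ih₂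
    exact ⟨max d₁ d₂, fun d hd A B h => and_congr (h₁ d (le_trans (le_max_left _ _) hd) A B h)
      (h₂ d (le_trans (le_max_right _ _) hd) A B h)⟩
  | ex φ ih =>
    obtain ⟨d₀, h₀⟩ := ih
    refine ⟨d₀ + 1, fun d hd A B h => ?_⟩
    obtain ⟨d, rfl⟩ : ∃ e, d = e + 1 := ⟨d - 1, by omega⟩
    have one : ∀ A B : Fin _ → Set C, mtype (d + 1) Set.univ A = mtype (d + 1) Set.univ B →
        φ.ex.Holds A → φ.ex.Holds B := by
      rintro A B h ⟨X, hX⟩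
      obtain ⟨Z, hZ⟩ := (mtype_succ_eq_iff.1 h).1 X
      exact ⟨Z, (h₀ d (by omega) _ _ hZ).1 hX⟩
    exact ⟨one A B h, one B A h.symm⟩

end Types

/-! ### Ramsey's theorem -/

/-- Infinite Ramsey theorem for pairs. -/
theorem exists_strictMono_homogeneous {α : Type*} [Finite α] (c : ℕ → ℕ → α) :
    ∃ (f : ℕ → ℕ) (a : α), StrictMono f ∧ ∀ i j, i < j → c (f i) (f j) = a := by
  have lim : ∀ g : ℕ → α, ∃ a, ∀ᶠ n in (Filter.hyperfilter ℕ : Filter ℕ), g n = a := by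
    intro g
    have hall : ∀ᶠ n in (Filter.hyperfilter ℕ : Filter ℕ), ∃ a : α, g n = a :=
      Filter.Eventually.of_forall fun n => ⟨_, rfl⟩
    exact Ultrafilter.eventually_exists_iff.1 hall
  choose l hl using fun i => lim (c i)
  obtain ⟨a, ha⟩ := lim l
  -- `l i` is the limit colour of the pairs `(i, n)` along the ultrafilter, and `a` the limit of
  -- `l`. Vertices with limit colour `a` are picked one by one: each new one comes from an
  -- intersection of finitely many sets of the ultrafilter.
  obtain ⟨f, hf⟩ := exists_seq_of_forall_finset_exists (fun n => l n = a)
    (fun i j => i < j ∧ c i j = a) (by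
      intro s hs
      have h1 : ∀ᶠ n in (Filter.hyperfilter ℕ : Filter ℕ), ∀ i ∈ s, i < n ∧ c i n = a := by
        rw [Filter.eventually_all_finset]
        intro i hi
        have h2 : ∀ᶠ n in (Filter.hyperfilter ℕ : Filter ℕ), i < n := by
          have : ∀ᶠ n in Filter.cofinite, i < n := by
            rw [Nat.cofinite_eq_atTop]; exact Filter.eventually_gt_atTop i
          exact Filter.hyperfilter_le_cofinite this
        filter_upwards [h2, hl i] with n hn hn'
        exact ⟨hn, hn'.trans (hs i hi)⟩
      obtain ⟨n, hn⟩ := (ha.and h1).exists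
      exact ⟨n, hn⟩)
  exact ⟨f, a, strictMono_nat_of_lt_succ fun n => (hf.2 n (n + 1) (Nat.lt_succ_self n)).1,
    fun i j hij => (hf.2 i j hij).2⟩

/-! ### Order reversal and renaming of variables -/

namespace MSOFormula

/-- The formula with all occurrences of `<` reversed. -/
def flip : {n : ℕ} → MSOFormula n → MSOFormula n
  | _, sub i j => sub i j
  | _, sing i => sing i
  | _, lt i j => lt j i
  | _, neg φ => neg φ.flip
  | _, and φ ψ => and φ.flip ψ.flip
  | _, ex φ => ex φ.flip

theorem holds_flip {C : Type u} [LinearOrder C] {n : ℕ} (φ : MSOFormula n) (A : Fin n → Set C) :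
    φ.flip.Holds (C := Cᵒᵈ) A ↔ φ.Holds A := by
  induction φ with
  | sub i j => exact Iff.rfl
  | sing i => exact Iff.rfl
  | lt i j =>
    exact ⟨fun ⟨x, y, hx, hy, h⟩ => ⟨y, x, hy, hx, h⟩, fun ⟨x, y, hx, hy, h⟩ => ⟨y, x, hy, hx, h⟩⟩
  | neg φ ih => exact not_congr (ih A)
  | and φ ψ ih₁ ih₂ => exact and_congr (ih₁ A) (ih₂ A)
  | ex φ ih => exact exists_congr fun B => ih _

theorem holds_flip' {C : Type u} [LinearOrder C] {n : ℕ} (φ : MSOFormula n) (A : Fin n → Set C) :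
    φ.flip.Holds A ↔ φ.Holds (C := Cᵒᵈ) A := by
  induction φ with
  | sub i j => exact Iff.rfl
  | sing i => exact Iff.rfl
  | lt i j =>
    exact ⟨fun ⟨x, y, hx, hy, h⟩ => ⟨y, x, hy, hx, h⟩, fun ⟨x, y, hx, hy, h⟩ => ⟨y, x, hy, hx, h⟩⟩
  | neg φ ih => exact not_congr (ih A)
  | and φ ψ ih₁ ih₂ => exact and_congr (ih₁ A) (ih₂ A)
  | ex φ ih => exact exists_congr fun B => ih _

/-- Renaming of the free variables. -/
def rename : {n : ℕ} → MSOFormula n → {k : ℕ} → (Fin n → Fin k) → MSOFormula k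
  | _, sub i j, _, f => sub (f i) (f j)
  | _, sing i, _, f => sing (f i)
  | _, lt i j, _, f => lt (f i) (f j)
  | _, neg φ, _, f => neg (φ.rename f)
  | _, and φ ψ, _, f => and (φ.rename f) (ψ.rename f)
  | _, ex φ, k, f => ex (φ.rename (Fin.snoc (fun i => (f i).castSucc) (Fin.last k) :
      Fin (_ + 1) → Fin (k + 1)))

theorem holds_rename {C : Type u} [LinearOrder C] {n : ℕ} (φ : MSOFormula n) {k : ℕ}
    (f : Fin n → Fin k) (A : Fin k → Set C) :
    (φ.rename f).Holds A ↔ φ.Holds (fun i => A (f i)) := by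
  induction φ generalizing k with
  | sub i j => exact Iff.rfl
  | sing i => exact Iff.rfl
  | lt i j => exact Iff.rfl
  | neg φ ih => exact not_congr (ih f A)
  | and φ ψ ih₁ ih₂ => exact and_congr (ih₁ f A) (ih₂ f A)
  | ex φ ih =>
    refine exists_congr fun B => ?_
    rw [ih]
    have : (fun i => (Fin.snoc A B : Fin (k + 1) → Set C)
        ((Fin.snoc (fun i => (f i).castSucc) (Fin.last k) : Fin (_ + 1) → Fin (k + 1)) i)) =
        (Fin.snoc (fun i => A (f i)) B : Fin (_ + 1) → Set C) := by
      funext i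
      refine Fin.lastCases ?_ (fun i => ?_) i <;> simp
    rw [this]

end MSOFormula

/-! ### Order types of at least `ω ^ k`, without ordinals -/

section Large

variable {C : Type u}

/-- `Large r k S` says that the strict order `r` restricted to `S` has order type at least
`ω ^ k`. -/
def Large (r : C → C → Prop) : ℕ → Set C → Prop
  | 0, S => S.Nonempty
  | k + 1, S => ∃ x : ℕ → C, (∀ i, r (x i) (x (i + 1))) ∧
      ∀ i, Large r k {y | y ∈ S ∧ ¬ r y (x i) ∧ r y (x (i + 1))}

theorem Large.mono {r : C → C → Prop} {k : ℕ} {S T : Set C} (hST : S ⊆ T) (h : Large r k S) :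
    Large r k T := by
  induction k generalizing S T with
  | zero => exact Set.Nonempty.mono hST h
  | succ k ih =>
    obtain ⟨x, hx, h⟩ := h
    exact ⟨x, hx, fun i => ih (fun y hy => ⟨hST hy.1, hy.2⟩) (h i)⟩

theorem Large.of_succ {r : C → C → Prop} {k : ℕ} {S : Set C} (h : Large r (k + 1) S) :
    Large r k S := by
  obtain ⟨x, -, h⟩ := h
  exact (h 0).mono fun y hy => hy.1

theorem Large.of_le {r : C → C → Prop} {k l : ℕ} {S : Set C} (hkl : k ≤ l) (h : Large r l S) :
    Large r k S := by
  induction hkl with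
  | refl => exact h
  | step _ ih => exact ih h.of_succ

theorem Large.nonempty {r : C → C → Prop} {k : ℕ} {S : Set C} (h : Large r k S) : S.Nonempty :=
  h.of_le (Nat.zero_le k)

theorem Large.image {D : Type*} {r : C → C → Prop} {s : D → D → Prop} (g : C → D)
    (hg : ∀ x y, r x y ↔ s (g x) (g y)) {k : ℕ} {S : Set C} (h : Large r k S) :
    Large s k (g '' S) := by
  induction k generalizing S with
  | zero => exact Set.Nonempty.image g h
  | succ k ih =>
    obtain ⟨x, hx, h⟩ := h
    refine ⟨fun i => g (x i), fun i => (hg _ _).1 (hx i), fun i => (ih (h i)).mono ?_⟩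
    rintro _ ⟨y, ⟨hy, h1, h2⟩, rfl⟩
    exact ⟨⟨y, hy, rfl⟩, fun h => h1 ((hg _ _).2 h), (hg _ _).1 h2⟩

theorem Large.not_subsingleton {r : C → C → Prop} {k : ℕ} {S : Set C} (h : Large r (k + 1) S) : ¬ S.Subsingleton := by
  intro hs
  obtain ⟨x, hx, h⟩ := h
  obtain ⟨y, hy, -, h1⟩ := (h 0).nonempty
  obtain ⟨z, hz, h2, -⟩ := (h 1).nonempty
  rw [hs hy hz] at h1
  exact h2 h1

variable {r : C → C → Prop} [IsStrictTotalOrder C r]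

theorem rel_of_lt {x : ℕ → C} (hx : ∀ i, r (x i) (x (i + 1))) {i j : ℕ} (hij : i < j) :
    r (x i) (x j) := by
  induction hij with
  | refl => exact hx i
  | step _ ih => exact _root_.trans ih (hx _)

theorem not_rel_of_le {x : ℕ → C} (hx : ∀ i, r (x i) (x (i + 1))) {i j : ℕ} (hij : i ≤ j) :
    ¬ r (x j) (x i) := by
  rcases hij.eq_or_lt with rfl | h
  · exact irrefl _
  · exact asymm (rel_of_lt hx h)

theorem not_rel_trans {a b c : C} (h1 : ¬ r a b) (h2 : ¬ r b c) : ¬ r a c := by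
  intro h
  rcases trichotomous_of r a b with h' | rfl | h'
  · exact h1 h'
  · exact h2 h
  · exact h2 (_root_.trans h' h)

theorem rel_of_rel_of_not {a b c : C} (h1 : r a b) (h2 : ¬ r c b) : r a c := by
  by_contra h
  exact not_rel_trans h h2 h1

/-- Along a subsequence of `x` the blocks only grow, so the bad blocks in between are swallowed. -/
theorem Large.of_frequently {k : ℕ} {S : Set C} {x : ℕ → C} (hx : ∀ i, r (x i) (x (i + 1)))
    (h : ∀ n, ∃ i, n ≤ i ∧ Large r k {y | y ∈ S ∧ ¬ r y (x i) ∧ r y (x (i + 1))}) :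
    Large r (k + 1) S := by
  obtain ⟨f, hf, hP⟩ := Filter.extraction_of_frequently_atTop (Filter.frequently_atTop.2 h)
  refine ⟨fun i => x (f i), fun i => rel_of_lt hx (hf (Nat.lt_succ_self i)),
    fun i => (hP i).mono ?_⟩
  rintro y ⟨hy, h1, h2⟩
  exact ⟨hy, h1, rel_of_rel_of_not h2 (not_rel_of_le hx (hf (Nat.lt_succ_self i)))⟩

/-- Additive indecomposability of `ω ^ k`: either infinitely many blocks are large in `S`, or from
some block on all are large in `T`. -/
theorem Large.union {k : ℕ} {S T : Set C} (h : Large r k (S ∪ T)) : Large r k S ∨ Large r k T := by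
  induction k generalizing S T with
  | zero => exact Set.union_nonempty.1 h
  | succ k ih =>
    obtain ⟨x, hx, h⟩ := h
    have h' : ∀ i, Large r k {y | y ∈ S ∧ ¬ r y (x i) ∧ r y (x (i + 1))} ∨
        Large r k {y | y ∈ T ∧ ¬ r y (x i) ∧ r y (x (i + 1))} := fun i =>
      ih ((h i).mono fun y hy => hy.1.imp (fun hs => ⟨hs, hy.2⟩) fun ht => ⟨ht, hy.2⟩)
    by_cases hS : ∀ n, ∃ i, n ≤ i ∧ Large r k {y | y ∈ S ∧ ¬ r y (x i) ∧ r y (x (i + 1))}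
    · exact Or.inl (Large.of_frequently hx hS)
    · push Not at hS
      obtain ⟨n, hn⟩ := hS
      exact Or.inr (Large.of_frequently hx fun m => ⟨max n m, le_max_right _ _,
        (h' _).resolve_left (hn _ (le_max_left _ _))⟩)

theorem Large.iUnion {ι : Type*} [Finite ι] {k : ℕ} {S : ι → Set C} (h : Large r k (⋃ i, S i)) :
    ∃ i, Large r k (S i) := by
  have key : ∀ t : Set ι, t.Finite → Large r k (⋃ i ∈ t, S i) → ∃ i, Large r k (S i) := by
    intro t ht
    induction t, ht using Set.Finite.induction_on with
    | empty => intro h; simpa using h.nonempty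
    | insert _ _ ih =>
      intro h
      rw [Set.biUnion_insert] at h
      exact h.union.elim (fun h => ⟨_, h⟩) ih
  exact key Set.univ Set.finite_univ (by simpa using h)

theorem Large.not_finite {S : Set C} (h : Large r 1 S) : ¬ S.Finite := by
  intro hs
  have := hs.to_subtype
  have hu : S = ⋃ s : S, {(s : C)} := by ext; simp
  rw [hu] at h
  obtain ⟨s, hs⟩ := h.iUnion
  exact hs.not_subsingleton Set.subsingleton_singleton

open Ordinal in
theorem large_iff_le_type {r : C → C → Prop} [IsWellOrder C r] {k : ℕ} :
    Large r k Set.univ ↔ ω ^ k ≤ Ordinal.type r := by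
  constructor
  -- The statement is localized for the induction: `ω ^ k` fits between the position of any `p`
  -- below `S` and any strict bound `o` of the positions in `S`.
  · have key : ∀ k : ℕ, ∀ (S : Set C) (p : C) (o : Ordinal), Large r k S →
        (∀ y ∈ S, ¬ r y p) → (∀ y ∈ S, typein r y < o) → typein r p + ω ^ k ≤ o := by
      intro k
      induction k with
      | zero =>
        rintro S p o ⟨y, hy⟩ h1 h2
        rw [pow_zero, Order.add_one_le_iff]
        exact ((typein_le_typein r).2 (h1 y hy)).trans_lt (h2 y hy)
      | succ k ih =>
        rintro S p o ⟨x, hx, h⟩ h1 h2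
        have hstep : ∀ i, typein r (x i) + ω ^ k ≤ typein r (x (i + 1)) := fun i =>
          ih _ _ _ (h i) (fun y hy => hy.2.1) fun y hy => (typein_lt_typein r).2 hy.2.2
        have hmul : ∀ n : ℕ, typein r p + ω ^ k * n ≤ typein r (x (n + 1)) := by
          intro n
          induction n with
          | zero =>
            obtain ⟨y, hy, -, hy'⟩ := (h 0).nonempty
            simpa using ((typein_le_typein r).2 (h1 y hy)).trans ((typein_lt_typein r).2 hy').le
          | succ n ihn =>
            rw [Nat.cast_succ, mul_add_one, ← add_assoc]
            exact (add_le_add_left ihn _).trans (hstep _)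
        have hlt : ∀ n : ℕ, typein r p + ω ^ k * n ≤ o := by
          intro n
          obtain ⟨y, hy, hy', -⟩ := (h (n + 1)).nonempty
          exact (hmul n).trans (((typein_le_typein r).2 hy').trans (h2 y hy).le)
        have hp : typein r p ≤ o := by simpa using hlt 0
        obtain ⟨o, rfl⟩ : ∃ q, o = typein r p + q := ⟨_, (Ordinal.add_sub_cancel_of_le hp).symm⟩
        refine add_le_add_right ?_ _
        rw [pow_succ, mul_le_iff_of_isSuccLimit isSuccLimit_omega0]
        intro b hb
        obtain ⟨n, rfl⟩ := lt_omega0.1 hb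
        exact (add_le_add_iff_left _).1 (hlt n)
    intro h
    obtain ⟨p, -⟩ := h.nonempty
    let p := IsWellFounded.wf.min (r := r) Set.univ ⟨p, trivial⟩
    exact le_add_self.trans (key k Set.univ p (Ordinal.type r) h
      (fun y _ => IsWellFounded.wf.not_lt_min Set.univ trivial) fun y _ => typein_lt_type r y)
  · have key : ∀ (k : ℕ) (o : Ordinal), o + ω ^ k ≤ Ordinal.type r →
        Large r k {y | o ≤ typein r y ∧ typein r y < o + ω ^ k} := by
      intro k
      induction k with
      | zero =>
        intro o ho
        rw [pow_zero] at ho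
        obtain ⟨y, hy⟩ := typein_surj r (Order.add_one_le_iff.1 ho)
        exact ⟨y, hy.ge, by rw [hy, pow_zero]; exact Order.lt_add_one_iff.2 le_rfl⟩
      | succ k ih =>
        intro o ho
        have hlt : ∀ n : ℕ, o + ω ^ k * n < o + ω ^ (k + 1) := by
          intro n
          rw [pow_succ]
          exact (add_lt_add_iff_left _).2
            ((mul_lt_mul_iff_right₀ (pow_pos omega0_pos k)).2 (natCast_lt_omega0 n))
        choose x hx using fun n : ℕ => typein_surj r ((hlt n).trans_le ho)
        have hs : ∀ n : ℕ, o + ω ^ k * n + ω ^ k = o + ω ^ k * (n + 1 : ℕ) := fun n => by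
          rw [Nat.cast_succ, mul_add_one, add_assoc]
        refine ⟨x, fun i => ?_, fun i => ?_⟩
        · rw [← typein_lt_typein r, hx, hx, ← hs]
          exact lt_add_of_pos_right _ (pow_pos omega0_pos k)
        · refine (ih (o + ω ^ k * i) (by rw [hs]; exact (hlt _).le.trans ho)).mono ?_
          rintro y ⟨h1, h2⟩
          rw [hs] at h2
          refine ⟨⟨le_self_add.trans h1, h2.trans (hlt _)⟩, ?_, ?_⟩
          · rw [← typein_le_typein r, hx]; exact h1
          · rw [← typein_lt_typein r, hx]; exact h2
    intro h
    exact (key k 0 (by simpa using h)).mono (Set.subset_univ _)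

end Large

/-! ### Homogeneous blocks and transfer of size across `ω`-sums -/

/-- The relation `R` is definable by a monadic formula with parameters. -/
def IsDefinableRel {C : Type u} [LinearOrder C] (R : C → C → Prop) : Prop :=
  ∃ (m : ℕ) (φ : MSOFormula (m + 2)) (P : Fin m → Set C), ∀ x y, φ.Rel P x y ↔ R x y

theorem IsDefinableRel.dual {C : Type u} [LinearOrder C] {R : C → C → Prop}
    (h : IsDefinableRel R) : IsDefinableRel (C := Cᵒᵈ) R := by
  obtain ⟨m, φ, P, h⟩ := h
  exact ⟨m, φ.flip, P, fun x y => (φ.holds_flip (C := C) _).trans (h x y)⟩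

section Uniqueness

variable {C : Type u} [LinearOrder C]

theorem mtype_cons_congr {d k : ℕ} {S X X' Y Y' : Set C} {P : Fin k → Set C}
    (hX : X ∩ S = X' ∩ S) (hY : Y ∩ S = Y' ∩ S) :
    mtype d S (Fin.cons X (Fin.cons Y P : Fin (k + 1) → Set C) : Fin (k + 2) → Set C) =
      mtype d S (Fin.cons X' (Fin.cons Y' P : Fin (k + 1) → Set C) : Fin (k + 2) → Set C) := by
  apply mtype_congr
  intro i
  refine Fin.cases ?_ (fun i => Fin.cases ?_ (fun i => ?_) i) i
  · simpa using hX
  · simpa using hY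
  · simp

/-- A chain cut at four points. -/
def cutPieces (b₀ b₁ b₂ b₃ : C) : Fin 5 → Set C :=
  ![Set.Iio b₀, Set.Ico b₀ b₁, Set.Ico b₁ b₂, Set.Ico b₂ b₃, Set.Ici b₃]

theorem cutPieces_lt {b₀ b₁ b₂ b₃ : C} (h₀ : b₀ ≤ b₁) (h₁ : b₁ ≤ b₂) (h₂ : b₂ ≤ b₃) (p q : Fin 5)
    (hpq : p < q) : ∀ x ∈ cutPieces b₀ b₁ b₂ b₃ p, ∀ y ∈ cutPieces b₀ b₁ b₂ b₃ q, x < y := by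
  have h02 := h₀.trans h₁
  have h13 := h₁.trans h₂
  have h03 := h02.trans h₂
  fin_cases p <;> fin_cases q <;> first
    | exact absurd hpq (by decide)
    | (intro x hx y hy
       simp only [cutPieces] at hx hy
       simp at hx hy
       grind)

theorem iUnion_cutPieces (b₀ b₁ b₂ b₃ : C) : ⋃ p, cutPieces b₀ b₁ b₂ b₃ p = Set.univ := by
  rw [Set.eq_univ_iff_forall]
  intro x
  rw [Set.mem_iUnion]
  rcases lt_or_ge x b₀ with h0 | h0
  · exact ⟨0, h0⟩
  rcases lt_or_ge x b₁ with h1 | h1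
  · exact ⟨1, h0, h1⟩
  rcases lt_or_ge x b₂ with h2 | h2
  · exact ⟨2, h1, h2⟩
  rcases lt_or_ge x b₃ with h3 | h3
  · exact ⟨3, h2, h3⟩
  · exact ⟨4, h3⟩

/-- Cutting the chain at the ends of the two blocks gives five pieces. Ramsey's theorem fixes the
types of the outer pieces and of the middle one; the colour of a point records the type of its own
block with the point marked. The composition theorem then determines the type of the pair, hence the
truth of each `R i`. -/
theorem exists_homogeneous_blocks {ι : Type} [Finite ι] {R : ι → C → C → Prop}
    (hR : ∀ i, IsDefinableRel (R i)) {a : ℕ → C} (ha : Monotone a) :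
    ∃ f : ℕ → ℕ, StrictMono f ∧ ∃ (K : Type) (_ : Finite K) (χ : ℕ → C → K),
      ∀ i m n m' n' x y x' y', m < n → m' < n' →
        x ∈ Set.Ico (a (f m)) (a (f (m + 1))) → y ∈ Set.Ico (a (f n)) (a (f (n + 1))) →
        x' ∈ Set.Ico (a (f m')) (a (f (m' + 1))) → y' ∈ Set.Ico (a (f n')) (a (f (n' + 1))) →
        χ n y = χ m x → χ m' x' = χ m x → χ n' y' = χ m x → (R i x y ↔ R i x' y') := by
  choose k φ P hφ using hR
  choose d hd using fun i => (φ i).exists_depth (C := C)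
  let τ : ∀ i, Set C → Set C → Set C → MSOType (d i) (k i + 2) := fun i S X Y =>
    mtype (d i) S (Fin.cons X (Fin.cons Y (P i) : Fin (k i + 1) → Set C) : Fin (k i + 2) → Set C)
  have τ_congr : ∀ i {S X X' Y Y' : Set C}, X ∩ S = X' ∩ S → Y ∩ S = Y' ∩ S →
    τ i S X Y = τ i S X' Y' := fun i _ _ _ _ _ h1 h2 => mtype_cons_congr h1 h2
  obtain ⟨f, c, hf, hc⟩ := exists_strictMono_homogeneous (α := ∀ i, MSOType (d i) (k i + 2) ×
    MSOType (d i) (k i + 2) × MSOType (d i) (k i + 2)) fun p q i =>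
    (τ i (Set.Iio (a p)) ∅ ∅, τ i (Set.Ico (a p) (a q)) ∅ ∅, τ i (Set.Ici (a p)) ∅ ∅)
  have hl : ∀ i m, τ i (Set.Iio (a (f m))) ∅ ∅ = (c i).1 := fun i m =>
    congrArg Prod.fst (congrFun (hc m (m + 1) (Nat.lt_succ_self m)) i)
  have hr : ∀ i m, τ i (Set.Ici (a (f m))) ∅ ∅ = (c i).2.2 := fun i m =>
    congrArg (fun t => t.2.2) (congrFun (hc m (m + 1) (Nat.lt_succ_self m)) i)
  have hm : ∀ i m n, m < n → τ i (Set.Ico (a (f m)) (a (f n))) ∅ ∅ = (c i).2.1 := fun i m n h =>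
    congrArg (fun t => t.2.1) (congrFun (hc m n h) i)
  -- The parity of the block index belongs to the colour: blocks of equal parity are not adjacent,
  -- so the middle piece has distinct end indices and the homogeneous type.
  refine ⟨f, hf, ∀ i, Bool × MSOType (d i) (k i + 2) × MSOType (d i) (k i + 2), inferInstance,
    fun m x i => (decide (Even m), τ i (Set.Ico (a (f m)) (a (f (m + 1)))) {x} ∅,
      τ i (Set.Ico (a (f m)) (a (f (m + 1)))) ∅ {x}), ?_⟩
  have haf : Monotone fun m => a (f m) := ha.comp hf.monotone
  have mid : ∀ i m n, (Even m ↔ Even n) → m < n →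
      τ i (Set.Ico (a (f (m + 1))) (a (f n))) ∅ ∅ = (c i).2.1 := by
    intro i m n h1 h2
    apply hm
    rcases Nat.lt_or_ge (m + 1) n with h | h
    · exact h
    · obtain rfl : n = m + 1 := by omega
      rw [Nat.even_add_one] at h1
      tauto
  intro i m n m' n' x y x' y' hmn hmn' hx hy hx' hy' e1 e2 e3
  have p1 : Even n ↔ Even m := by simpa using congrArg Prod.fst (congrFun e1 i)
  have p2 : Even m' ↔ Even m := by simpa using congrArg Prod.fst (congrFun e2 i)
  have p3 : Even n' ↔ Even m := by simpa using congrArg Prod.fst (congrFun e3 i)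
  have q2 := congrArg (fun t => t.2.1) (congrFun e2 i)
  have q1 := congrArg (fun t => t.2.2) (congrFun e1 i)
  have q3 := congrArg (fun t => t.2.2) (congrFun e3 i)
  simp only at q1 q2 q3
  rw [← hφ i, ← hφ i]
  refine hd i (d i) le_rfl _ _ ?_
  have types : ∀ m n x y, m < n → (Even m ↔ Even n) → x ∈ Set.Ico (a (f m)) (a (f (m + 1))) →
      y ∈ Set.Ico (a (f n)) (a (f (n + 1))) → ∀ p,
      τ i (cutPieces (a (f m)) (a (f (m + 1))) (a (f n)) (a (f (n + 1))) p) {x} {y} =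
      (![(c i).1, τ i (Set.Ico (a (f m)) (a (f (m + 1)))) {x} ∅, (c i).2.1,
        τ i (Set.Ico (a (f n)) (a (f (n + 1)))) ∅ {y}, (c i).2.2] :
        Fin 5 → MSOType (d i) (k i + 2)) p := by
    intro m n x y hmn hpar hx hy p
    have h0 : a (f m) ≤ a (f (m + 1)) := haf (Nat.le_succ m)
    have h1 : a (f (m + 1)) ≤ a (f n) := haf hmn
    have h2 : a (f n) ≤ a (f (n + 1)) := haf (Nat.le_succ n)
    have disj : ∀ (z : C) (S : Set C), z ∉ S → {z} ∩ S = ∅ ∩ S := fun z S h => by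
      rw [Set.empty_inter, Set.singleton_inter_eq_empty]; exact h
    obtain ⟨hx1, hx2⟩ := hx
    obtain ⟨hy1, hy2⟩ := hy
    fin_cases p
    · refine (τ_congr i (disj _ _ ?_) (disj _ _ ?_)).trans (hl i m)
      · exact fun h => absurd h (not_lt.2 hx1)
      · exact fun h => absurd h (not_lt.2 (h0.trans (h1.trans hy1)))
    · refine τ_congr i rfl (disj _ _ ?_)
      exact fun h => absurd h.2 (not_lt.2 (h1.trans hy1))
    · refine (τ_congr i (disj _ _ ?_) (disj _ _ ?_)).trans (mid i m n hpar hmn)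
      · exact fun h => absurd h.1 (not_le.2 hx2)
      · exact fun h => absurd h.2 (not_lt.2 hy1)
    · refine τ_congr i (disj _ _ ?_) rfl
      exact fun h => absurd h.1 (not_le.2 (hx2.trans_le h1))
    · refine (τ_congr i (disj _ _ ?_) (disj _ _ ?_)).trans (hr i (n + 1))
      · exact fun h => absurd h (not_le.2 (hx2.trans_le (h1.trans h2)))
      · exact fun h => absurd h (not_le.2 hy2)
  have lt' : ∀ m n, m < n → ∀ p q, p < q →
      ∀ x ∈ cutPieces (a (f m)) (a (f (m + 1))) (a (f n)) (a (f (n + 1))) p,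
      ∀ y ∈ cutPieces (a (f m)) (a (f (m + 1))) (a (f n)) (a (f (n + 1))) q, x < y :=
    fun m n hmn => cutPieces_lt (haf (Nat.le_succ m)) (haf hmn) (haf (Nat.le_succ n))
  rw [← iUnion_cutPieces (a (f m)) (a (f (m + 1))) (a (f n)) (a (f (n + 1)))]
  conv_rhs => rw [iUnion_cutPieces, ← iUnion_cutPieces (a (f m')) (a (f (m' + 1))) (a (f n'))
    (a (f (n' + 1)))]
  refine mtype_iUnion (d i) (lt' m n hmn) (lt' m' n' hmn') fun p => ?_
  refine (types m n x y hmn p1.symm hx hy p).trans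
    (Eq.trans ?_ (types m' n' x' y' hmn' (p2.trans p3.symm) hx' hy' p).symm)
  rw [q2, q1, q3]

end Uniqueness

section Uniqueness

variable {C : Type u} [LinearOrder C]

/-- By homogeneity one failure of `t` between different blocks would mean failure throughout the
colour `s`. But the `t`-least point of that colour does precede any point of the colour in a later
block. -/
theorem rel_of_homogeneous {t : C → C → Prop} [IsWellOrder C t] {b : ℕ → C} (hb : Monotone b)
    {K : Type} {χ : ℕ → C → K} (hχ : ∀ m n m' n' x y x' y', m < n → m' < n' →
        x ∈ Set.Ico (b m) (b (m + 1)) → y ∈ Set.Ico (b n) (b (n + 1)) →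
        x' ∈ Set.Ico (b m') (b (m' + 1)) → y' ∈ Set.Ico (b n') (b (n' + 1)) →
        χ n y = χ m x → χ m' x' = χ m x → χ n' y' = χ m x → (t x y ↔ t x' y'))
    {s : K} (hs : ∀ N, ∃ m, N ≤ m ∧ ∃ x ∈ Set.Ico (b m) (b (m + 1)), χ m x = s)
    {m n : ℕ} {x y : C} (hmn : m < n) (hx : x ∈ Set.Ico (b m) (b (m + 1)))
    (hy : y ∈ Set.Ico (b n) (b (n + 1))) (hxs : χ m x = s) (hys : χ n y = s) : t x y := by
  by_contra hno
  have hne : {z | ∃ m, z ∈ Set.Ico (b m) (b (m + 1)) ∧ χ m z = s}.Nonempty := ⟨x, m, hx, hxs⟩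
  have wf : WellFounded t := IsWellFounded.wf
  obtain ⟨p, hp, hps⟩ := wf.min_mem _ hne
  obtain ⟨q, hq, w, hw, hws⟩ := hs (p + 1)
  have h1 : ¬ t (wf.min _ hne) w := fun h => hno <|
    (hχ p q m n _ _ x y hq hmn hp hw hx hy (hws.trans hps.symm) (hxs.trans hps.symm)
      (hys.trans hps.symm)).1 h
  have h2 : wf.min _ hne < w := hp.2.trans_le ((hb hq).trans hw.1)
  rcases trichotomous_of t (wf.min _ hne) w with h | h | h
  · exact h1 h
  · exact h2.ne h
  · exact wf.not_lt_min {z | ∃ m, z ∈ Set.Ico (b m) (b (m + 1)) ∧ χ m z = s} ⟨q, hw, hws⟩ h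

theorem large_ico {r s : C → C → Prop} [IsWellOrder C r] [IsWellOrder C s] {a : ℕ → C}
    (ha : Monotone a) (h : ∀ i k, Large r k (Set.Ico (a i) (a (i + 1))) →
      Large s k (Set.Ico (a i) (a (i + 1)))) {i j k : ℕ}
    (hr : Large r k (Set.Ico (a i) (a j))) : Large s k (Set.Ico (a i) (a j)) := by
  rcases lt_or_ge j i with hij | hij
  · have := hr.nonempty
    rw [Set.Ico_eq_empty (not_lt.2 (ha hij.le))] at this
    exact absurd this Set.not_nonempty_empty
  induction hij with
  | refl =>
    have := hr.nonempty
    rw [Set.Ico_self] at this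
    exact absurd this Set.not_nonempty_empty
  | @step j hij ih =>
    rw [← Set.Ico_union_Ico_eq_Ico (ha hij) (ha (Nat.le_succ j))] at hr ⊢
    rcases hr.union with h1 | h1
    · exact (ih h1).mono Set.subset_union_left
    · exact (h j k h1).mono Set.subset_union_right

/-- A recurring colour carrying `ω ^ (k + 1)` for `r` is `r`-increasing over blocks, so infinitely
many blocks carry `ω ^ k` for `r`, hence for `s`. A colour that is `s`-large in infinitely many of
these is `s`-increasing over blocks, and concatenation gives `ω ^ (k + 1)` for `s`. -/
theorem large_iUnion_ico {r s : C → C → Prop} [IsWellOrder C r] [IsWellOrder C s]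
    (hr : IsDefinableRel r) (hs : IsDefinableRel s) {a : ℕ → C} (ha : Monotone a)
    (h : ∀ i k, Large r k (Set.Ico (a i) (a (i + 1))) → Large s k (Set.Ico (a i) (a (i + 1))))
    {k : ℕ} (hk : Large r k {x | a 0 ≤ x ∧ ∃ i, x < a i}) :
    Large s k {x | a 0 ≤ x ∧ ∃ i, x < a i} := by
  cases k with
  | zero => exact hk
  | succ k =>
  by_contra hno
  obtain ⟨f, hf, K, hK, χ, hχ⟩ := exists_homogeneous_blocks
    (R := fun i : Bool => if i then s else r) (by rintro (_ | _) <;> simpa) ha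
  have hχr := hχ false
  have hχs := hχ true
  simp only [if_true, Bool.false_eq_true, if_false] at hχr hχs
  set J := {x | a 0 ≤ x ∧ ∃ i, x < a i} with hJ
  have hb : Monotone fun m => a (f m) := ha.comp hf.monotone
  have hsub : ∀ i j, Set.Ico (a i) (a j) ⊆ J := fun i j x hx =>
    ⟨(ha (Nat.zero_le i)).trans hx.1, j, hx.2⟩
  have hfin : ∀ i j, ¬ Large r (k + 1) (Set.Ico (a i) (a j)) := fun i j h' =>
    hno ((large_ico ha h h').mono (hsub i j))
  have hcover : J ⊆ Set.Ico (a 0) (a (f 0)) ∪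
      ⋃ c : K, {x | ∃ m, x ∈ Set.Ico (a (f m)) (a (f (m + 1))) ∧ χ m x = c} := by
    rintro x ⟨hx0, i, hi⟩
    have hex : ∃ n, x < a (f n) := ⟨i, hi.trans_le (ha (hf.id_le i))⟩
    classical
    rcases hn : Nat.find hex with _ | n
    · left
      have := Nat.find_spec hex
      rw [hn] at this
      exact ⟨hx0, this⟩
    · right
      have h1 := Nat.find_spec hex
      have h2 := Nat.find_min hex (m := n) (by omega)
      rw [hn] at h1
      exact Set.mem_iUnion.2 ⟨χ n x, n, ⟨not_lt.1 h2, h1⟩, rfl⟩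
  rcases (hk.mono hcover).union with h1 | h1
  · exact hfin _ _ h1
  obtain ⟨c, hc⟩ := h1.iUnion
  have tail : ∀ N, Large r (k + 1)
      {x | a (f N) ≤ x ∧ ∃ m, x ∈ Set.Ico (a (f m)) (a (f (m + 1))) ∧ χ m x = c} := by
    intro N
    refine ((hc.mono ?_).union).resolve_left (hfin (f 0) (f N))
    rintro x ⟨m, hm, hmc⟩
    rcases lt_or_ge x (a (f N)) with h' | h'
    · exact Or.inl ⟨(hb (Nat.zero_le m)).trans hm.1, h'⟩
    · exact Or.inr ⟨h', m, hm, hmc⟩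
  have tail_le : ∀ N m x, a (f N) ≤ x → x ∈ Set.Ico (a (f m)) (a (f (m + 1))) → N ≤ m := by
    intro N m x h1 h2
    by_contra! h3
    exact absurd (h2.2.trans_le (hb h3)) (not_lt.2 h1)
  have hincr := fun {m n x y} => rel_of_homogeneous (t := r) hb hχr (s := c) (fun N => by
    obtain ⟨x, hx, m, hm, hmc⟩ := (tail N).nonempty
    exact ⟨m, tail_le N m x hx hm, x, hm, hmc⟩) (m := m) (n := n) (x := x) (y := y)
  have hmany : ∀ N, ∃ m, N ≤ m ∧ Large r k (Set.Ico (a (f m)) (a (f (m + 1)))) := by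
    intro N
    obtain ⟨x, hx, hl⟩ := tail N
    obtain ⟨y, ⟨-, n, hyn, hyc⟩, hy1, -⟩ := (hl 1).nonempty
    -- A point `y` of colour `c` in block `n`, not `r`-below `x 1`, confines the points of that
    -- colour `r`-below `x 1` to blocks of index at most `n`; one of these finitely many blocks is
    -- therefore large.
    have : {z | z ∈ {x | a (f N) ≤ x ∧ ∃ m, x ∈ Set.Ico (a (f m)) (a (f (m + 1))) ∧ χ m x = c} ∧
        ¬ r z (x 0) ∧ r z (x 1)} ⊆
        ⋃ p : Fin (n + 1), {z | N ≤ (p : ℕ) ∧ z ∈ Set.Ico (a (f p)) (a (f (p + 1)))} := by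
      rintro z ⟨⟨hzN, m, hzm, hzc⟩, -, hz1⟩
      have hmn : m ≤ n := by
        by_contra! hmn
        exact asymm (hincr hmn hyn hzm hyc hzc) (rel_of_rel_of_not hz1 hy1)
      exact Set.mem_iUnion.2 ⟨⟨m, by omega⟩, tail_le N m z hzN hzm, hzm⟩
    obtain ⟨p, hp⟩ := ((hl 0).mono this).iUnion
    obtain ⟨_, hNp, -⟩ := hp.nonempty
    exact ⟨p, hNp, hp.mono fun z hz => hz.2⟩
  have hcol : ∃ e : K, ∀ N, ∃ m, N ≤ m ∧
      Large s k {x | x ∈ Set.Ico (a (f m)) (a (f (m + 1))) ∧ χ m x = e} := by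
    by_contra! hcon
    choose N hN using hcon
    obtain ⟨M, hM⟩ := (Set.finite_range N).bddAbove
    obtain ⟨m, hm, hl⟩ := hmany M
    have : Set.Ico (a (f m)) (a (f (m + 1))) ⊆
        ⋃ e : K, {x | x ∈ Set.Ico (a (f m)) (a (f (m + 1))) ∧ χ m x = e} :=
      fun x hx => Set.mem_iUnion.2 ⟨χ m x, hx, rfl⟩
    obtain ⟨e, he⟩ := ((large_ico ha h hl).mono this).iUnion
    exact hN e m ((hM ⟨e, rfl⟩).trans hm) he
  obtain ⟨e, he⟩ := hcol
  have hincr' := fun {m n x y} => rel_of_homogeneous (t := s) hb hχs (s := e) (fun N => by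
    obtain ⟨m, hm, hl⟩ := he N
    obtain ⟨x, hx, hxe⟩ := hl.nonempty
    exact ⟨m, hm, x, hx, hxe⟩) (m := m) (n := n) (x := x) (y := y)
  obtain ⟨g, hg, hgl⟩ := Filter.extraction_of_frequently_atTop (Filter.frequently_atTop.2 he)
  have wf : WellFounded s := IsWellFounded.wf
  have hmem := fun i => wf.min_mem _ (hgl i).nonempty
  -- The `s`-least points of the selected coloured blocks serve as the cut points.
  refine hno ⟨fun i => wf.min _ (hgl i).nonempty, fun i =>
    hincr' (hg (Nat.lt_succ_self i)) (hmem i).1 (hmem (i + 1)).1 (hmem i).2 (hmem (i + 1)).2,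
    fun i => (hgl i).mono ?_⟩
  rintro z ⟨hz, hze⟩
  exact ⟨hsub _ _ hz, wf.not_lt_min
    {x | x ∈ Set.Ico (a (f (g i))) (a (f (g i + 1))) ∧ χ (g i) x = e} ⟨hz, hze⟩,
    hincr' (hg (Nat.lt_succ_self i)) hz (hmem (i + 1)).1 hze (hmem (i + 1)).2⟩

end Uniqueness

/-! ### Induction on countable scattered chains -/

section Scattered

/-- Countability provides a cofinal sequence, so a convex set without maximum is an `ω`-sum of
intervals to the right of `p`. -/
theorem ici_of_ico {C : Type u} [LinearOrder C] [Countable C] {P : Set C → Prop}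
    (hup : ∀ a : ℕ → C, Monotone a → (∀ i, P (Set.Ico (a i) (a (i + 1)))) →
      P {x | a 0 ≤ x ∧ ∃ i, x < a i})
    {J : Set C} (hJ : J.OrdConnected) {p : C} (hp : p ∈ J)
    (hico : ∀ b ∈ J, ∀ c ∈ J, b ≤ c → P (Set.Ico b c)) (hicc : ∀ c ∈ J, p ≤ c → P (Set.Icc p c)) :
    P (J ∩ Set.Ici p) := by
  by_cases hmax : ∃ m ∈ J, ∀ x ∈ J, x ≤ m
  · obtain ⟨m, hm, hmax⟩ := hmax
    have : J ∩ Set.Ici p = Set.Icc p m := by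
      ext x
      exact ⟨fun h => ⟨h.2, hmax x h.1⟩, fun h => ⟨hJ.out hp hm h, h.1⟩⟩
    rw [this]
    exact hicc m hm (hmax p hp)
  · push Not at hmax
    have : Nonempty ↥(J ∩ Set.Ici p) := ⟨⟨p, hp, le_rfl⟩⟩
    obtain ⟨xs, hxs, hlim⟩ := Filter.exists_seq_monotone_tendsto_atTop_atTop ↥(J ∩ Set.Ici p)
    let a : ℕ → C := fun n => Nat.casesOn n p fun n => xs n
    have haJ : ∀ n, a n ∈ J := by
      rintro (_ | n)
      · exact hp
      · exact (xs n).2.1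
    have ha : Monotone a := by
      apply monotone_nat_of_le_succ
      rintro (_ | n)
      · exact (xs 0).2.2
      · exact hxs (Nat.le_succ n)
    have hset : {x | a 0 ≤ x ∧ ∃ i, x < a i} = J ∩ Set.Ici p := by
      ext x
      constructor
      · rintro ⟨h0, i, hi⟩
        exact ⟨hJ.out hp (haJ i) ⟨h0, hi.le⟩, h0⟩
      · rintro ⟨h1, h2⟩
        obtain ⟨y, hy, hxy⟩ := hmax x h1
        obtain ⟨n, hn⟩ := (hlim.eventually_ge_atTop ⟨y, hy, le_trans h2 hxy.le⟩).exists
        exact ⟨h2, n + 1, hxy.trans_le hn⟩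
    rw [← hset]
    exact hup a ha fun i => hico _ (haJ i) _ (haJ (i + 1)) (ha (Nat.le_succ i))

/-- Induction on countable scattered chains: the whole chain is reached from one point by unions,
`ω`-sums and `ω*`-sums. -/
theorem IsScatteredChain.induction {C : Type u} [LinearOrder C] [Countable C]
    (hC : IsScatteredChain C) {P : Set C → Prop} (hsub : ∀ S : Set C, S.Subsingleton → P S)
    (hunion : ∀ S T : Set C, P S → P T → P (S ∪ T))
    (hup : ∀ a : ℕ → C, Monotone a → (∀ i, P (Set.Ico (a i) (a (i + 1)))) →
      P {x | a 0 ≤ x ∧ ∃ i, x < a i})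
    (hdown : ∀ a : ℕ → C, Antitone a → (∀ i, P (Set.Ioc (a (i + 1)) (a i))) →
      P {x | x ≤ a 0 ∧ ∃ i, a i < x}) : P Set.univ := by
  -- The property is made hereditary for convex subsets; `E` below is then a convex equivalence
  -- relation, as in Hausdorff's condensation.
  let Q : Set C → Prop := fun S => ∀ J ⊆ S, J.OrdConnected → P J
  have Qmono : ∀ {S T : Set C}, S ⊆ T → Q T → Q S := fun h hT J hJ => hT J (hJ.trans h)
  have Qunion : ∀ {S T U : Set C}, S.OrdConnected → T.OrdConnected → Q S → Q T → U ⊆ S ∪ T →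
      Q U := by
    intro S T U hS hT hQS hQT hU J hJ hJc
    have : J = (J ∩ S) ∪ (J ∩ T) := by
      rw [← Set.inter_union_distrib_left, eq_comm, Set.inter_eq_left]
      exact hJ.trans hU
    rw [this]
    exact hunion _ _ (hQS _ Set.inter_subset_right (hJc.inter hS))
      (hQT _ Set.inter_subset_right (hJc.inter hT))
  let E : C → C → Prop := fun x y => Q (Set.uIcc x y)
  have Erefl : ∀ x, E x x := fun x J hJ _ =>
    hsub J (Set.subsingleton_singleton.anti (by simpa using hJ))
  have Esymm : ∀ {x y}, E x y → E y x := fun {x y} h => by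
    simpa only [E, Set.uIcc_comm] using h
  have Etrans : ∀ {x y z}, E x y → E y z → E x z := fun {x y z} h1 h2 =>
    Qunion Set.ordConnected_uIcc Set.ordConnected_uIcc h1 h2 Set.uIcc_subset_uIcc_union_uIcc
  have Eclass : ∀ J : Set C, J.OrdConnected → (∀ x ∈ J, ∀ y ∈ J, E x y) → P J := by
    intro J hJ hE
    rcases J.eq_empty_or_nonempty with rfl | ⟨p, hp⟩
    · exact hsub _ Set.subsingleton_empty
    have h1 : P (J ∩ Set.Ici p) := ici_of_ico hup hJ hp
      (fun b hb c hc hbc => hE b hb c hc _ (by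
        rw [Set.uIcc_of_le hbc]; exact Set.Ico_subset_Icc_self) Set.ordConnected_Ico)
      (fun c hc hpc => hE p hp c hc _ (by rw [Set.uIcc_of_le hpc]) Set.ordConnected_Icc)
    have : Countable Cᵒᵈ := ‹Countable C›
    have h2 : P (J ∩ Set.Iic p) := ici_of_ico (C := Cᵒᵈ) (P := P)
      (fun a ha h => hdown a (fun i j hij => ha hij) fun i => by
        have := h i
        have he : (Set.Ico (a i) (a (i + 1)) : Set Cᵒᵈ) =
          (Set.Ioc (OrderDual.ofDual (a (i + 1))) (OrderDual.ofDual (a i)) : Set C) := by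
          ext x; exact and_comm
        rw [he] at this
        exact this)
      hJ.dual hp
      (fun b hb c hc hbc => by
        refine hE c hc b hb _ ?_ (Set.OrdConnected.dual (α := Cᵒᵈ) Set.ordConnected_Ico)
        intro x hx
        exact Set.Icc_subset_uIcc ⟨hx.2.le, hx.1⟩)
      (fun c hc hpc => by
        refine hE c hc p hp _ ?_ (Set.OrdConnected.dual (α := Cᵒᵈ) Set.ordConnected_Icc)
        intro x hx
        exact Set.Icc_subset_uIcc ⟨hx.2, hx.1⟩)
    have := hunion _ _ h1 h2
    rwa [← Set.inter_union_distrib_left, Set.union_comm, Set.Iic_union_Ici, Set.inter_univ] at this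
  by_cases hall : ∀ x y, E x y
  · exact Eclass _ Set.ordConnected_univ fun x _ y _ => hall x y
  exfalso
  push Not at hall
  obtain ⟨x₀, y₀, h₀⟩ := hall
  -- If every point between `x` and `y` were equivalent to one of them, the interval would be the
  -- union of two convex sets, each inside one class, and `x`, `y` would be equivalent.
  have dense : ∀ x y, x < y → ¬ E x y → ∃ z, x < z ∧ z < y ∧ ¬ E x z ∧ ¬ E z y := by
    intro x y hxy hE
    by_contra! hcon
    apply hE
    have conv : ∀ w : C, Set.OrdConnected {z | z ∈ Set.Icc x y ∧ E w z} := by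
      intro w
      refine ⟨?_⟩
      rintro b ⟨hb, hb'⟩ c ⟨hc, hc'⟩ z ⟨hz1, hz2⟩
      refine ⟨⟨hb.1.trans hz1, hz2.trans hc.2⟩, Etrans hb' ?_⟩
      refine Qmono ?_ (Etrans (Esymm hb') hc')
      rw [Set.uIcc_of_le hz1, Set.uIcc_of_le (hz1.trans hz2)]
      exact Set.Icc_subset_Icc_right hz2
    have hQ : ∀ w : C, Q {z | z ∈ Set.Icc x y ∧ E w z} := fun w J hJ hJc =>
      Eclass J hJc fun b hb c hc => Etrans (Esymm (hJ hb).2) (hJ hc).2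
    refine Qunion (conv x) (conv y) (hQ x) (hQ y) ?_
    rw [Set.uIcc_of_le hxy.le]
    intro z hz
    rcases hz.1.eq_or_lt with rfl | h1
    · exact Or.inl ⟨hz, Erefl _⟩
    rcases hz.2.eq_or_lt with rfl | h2
    · exact Or.inr ⟨hz, Erefl _⟩
    by_cases hE' : E x z
    · exact Or.inl ⟨hz, hE'⟩
    · exact Or.inr ⟨hz, Esymm (hcon z h1 h2 hE')⟩
  let st : Setoid C := ⟨E, Erefl, Esymm, Etrans⟩
  let rep : C → C := fun x => (Quotient.mk st x).out
  have hrep : ∀ x, E (rep x) x := fun x => Quotient.exact (Quotient.out_eq (Quotient.mk st x))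
  have hrep' : ∀ x y, E x y → rep x = rep y := fun x y h =>
    congrArg Quotient.out (Quotient.sound (s := st) h)
  have rr : ∀ x, rep (rep x) = rep x := fun x => hrep' _ _ (hrep x)
  let T := Set.range rep
  have : Nontrivial T := ⟨⟨rep x₀, x₀, rfl⟩, ⟨rep y₀, y₀, rfl⟩, fun h => h₀ <| by
    have h' : rep x₀ = rep y₀ := congrArg Subtype.val h
    exact Etrans (Esymm (hrep x₀)) (h' ▸ hrep y₀)⟩
  -- Representatives of the classes form a dense chain with at least two points, into which `ℚ`
  -- embeds.
  have : DenselyOrdered T := by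
    refine ⟨?_⟩
    rintro ⟨_, x, rfl⟩ ⟨_, y, rfl⟩ hxy
    have hxy' : rep x < rep y := hxy
    have hne : ¬ E (rep x) (rep y) := fun h => hxy'.ne (by
      have := hrep' _ _ h
      rwa [rr, rr] at this)
    obtain ⟨z, h1, h2, h3, h4⟩ := dense _ _ hxy' hne
    refine ⟨⟨rep z, z, rfl⟩, ?_, ?_⟩
    · show rep x < rep z
      by_contra! h
      apply h3
      refine Qmono ?_ (hrep z)
      rw [Set.uIcc_of_le h1.le, Set.uIcc_of_le (h.trans h1.le)]
      exact Set.Icc_subset_Icc_left h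
    · show rep z < rep y
      by_contra! h
      apply h4
      refine Qmono ?_ (Esymm (hrep z))
      rw [Set.uIcc_of_le h2.le, Set.uIcc_of_le (h2.le.trans h)]
      exact Set.Icc_subset_Icc_right h
  obtain ⟨emb⟩ := Order.embedding_from_countable_to_dense ℚ T
  exact hC.false (emb.trans (OrderEmbedding.subtype _))

end Scattered

/-! ### Definable well-orderings reach the same powers of `ω` -/

section Uniqueness

theorem large_univ_of_definable {C : Type u} [LinearOrder C] [Countable C]
    (hC : IsScatteredChain C) {r s : C → C → Prop} [IsWellOrder C r] [IsWellOrder C s]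
    (hr : IsDefinableRel r) (hs : IsDefinableRel s) {k : ℕ} (h : Large r k Set.univ) :
    Large s k Set.univ := by
  refine hC.induction (P := fun S => ∀ k, Large r k S → Large s k S) ?_ ?_ ?_ ?_ k h
  · rintro S hS (_ | k) hl
    · exact hl
    · exact absurd hS hl.not_subsingleton
  · intro S T hS hT k hl
    rcases hl.union with h1 | h1
    · exact (hS k h1).mono Set.subset_union_left
    · exact (hT k h1).mono Set.subset_union_right
  · intro a ha hi k hl
    exact large_iUnion_ico hr hs ha hi hl
  · intro a ha hi k hl
    have : IsWellOrder Cᵒᵈ r := ‹IsWellOrder C r›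
    have : IsWellOrder Cᵒᵈ s := ‹IsWellOrder C s›
    refine large_iUnion_ico (C := Cᵒᵈ) hr.dual hs.dual (a := a) (fun i j hij => ha hij) ?_ hl
    intro i k hl'
    have he : (Set.Ico (OrderDual.toDual (a i)) (OrderDual.toDual (a (i + 1))) : Set Cᵒᵈ) =
        (Set.Ioc (a (i + 1)) (a i) : Set C) := by
      ext x; exact and_comm
    exact (hi i k (hl'.mono he.subset)).mono he.superset

end Uniqueness

/-! ### Closure properties of definable relations and layered orders -/

section Definability

variable {C : Type u} [LinearOrder C]

theorem IsDefinableRel.congr {R S : C → C → Prop} (h : IsDefinableRel R)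
    (hRS : ∀ x y, R x y ↔ S x y) : IsDefinableRel S := by
  obtain ⟨m, φ, P, h⟩ := h
  exact ⟨m, φ, P, fun x y => (h x y).trans (hRS x y)⟩

theorem IsDefinableRel.not {R : C → C → Prop} (h : IsDefinableRel R) :
    IsDefinableRel fun x y => ¬ R x y := by
  obtain ⟨m, φ, P, h⟩ := h
  exact ⟨m, φ.neg, P, fun x y => not_congr (h x y)⟩

theorem IsDefinableRel.and {R S : C → C → Prop} (hR : IsDefinableRel R) (hS : IsDefinableRel S) :
    IsDefinableRel fun x y => R x y ∧ S x y := by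
  obtain ⟨m, φ, P, hφ⟩ := hR
  obtain ⟨k, ψ, Q, hψ⟩ := hS
  let f : Fin (m + 2) → Fin (m + k + 2) := Fin.cons 0 (Fin.cons 1 fun i =>
    (Fin.castAdd k i).succ.succ : Fin (m + 1) → Fin (m + k + 2))
  let g : Fin (k + 2) → Fin (m + k + 2) := Fin.cons 0 (Fin.cons 1 fun i =>
    (Fin.natAdd m i).succ.succ : Fin (k + 1) → Fin (m + k + 2))
  refine ⟨m + k, (φ.rename f).and (ψ.rename g), Fin.append P Q, fun x y => ?_⟩
  refine and_congr ((MSOFormula.holds_rename φ f _).trans ?_)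
    ((MSOFormula.holds_rename ψ g _).trans ?_)
  · rw [← hφ x y]
    refine iff_of_eq (congrArg φ.Holds (funext fun i => ?_))
    refine Fin.cases rfl (fun i => Fin.cases rfl (fun i => ?_) i) i
    simp [f]
  · rw [← hψ x y]
    refine iff_of_eq (congrArg ψ.Holds (funext fun i => ?_))
    refine Fin.cases rfl (fun i => Fin.cases rfl (fun i => ?_) i) i
    simp [g]

theorem IsDefinableRel.or {R S : C → C → Prop} (hR : IsDefinableRel R) (hS : IsDefinableRel S) :
    IsDefinableRel fun x y => R x y ∨ S x y :=
  (hR.not.and hS.not).not.congr fun x y => by tauto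

theorem IsDefinableRel.swap {R : C → C → Prop} (hR : IsDefinableRel R) :
    IsDefinableRel fun x y => R y x := by
  obtain ⟨m, φ, P, hφ⟩ := hR
  let f : Fin (m + 2) → Fin (m + 2) := Fin.cons 1 (Fin.cons 0 fun i =>
    i.succ.succ : Fin (m + 1) → Fin (m + 2))
  refine ⟨m, φ.rename f, P, fun x y => (MSOFormula.holds_rename φ f _).trans ?_⟩
  refine Iff.trans ?_ (hφ y x)
  refine iff_of_eq (congrArg φ.Holds (funext fun i => ?_))
  refine Fin.cases rfl (fun i => Fin.cases rfl (fun i => ?_) i) i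
  simp [f]

theorem isDefinableRel_lt : IsDefinableRel fun x y : C => x < y := by
  refine ⟨0, MSOFormula.lt 0 1, Fin.elim0, fun x y => ?_⟩
  constructor
  · rintro ⟨a, b, ha, hb, h⟩
    rw [Set.singleton_eq_singleton_iff.1 ha, Set.singleton_eq_singleton_iff.1 hb]
    exact h
  · exact fun h => ⟨x, y, rfl, rfl, h⟩

theorem isDefinableRel_mem (S : Set C) : IsDefinableRel fun x _ : C => x ∈ S :=
  ⟨1, MSOFormula.sub 0 2, fun _ => S, fun _ _ => Set.singleton_subset_iff⟩

theorem isDefinableRel_exists_between (S : Set C) :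
    IsDefinableRel fun x y : C => ∃ z ∈ S, x < z ∧ z < y := by
  refine ⟨1, ((MSOFormula.sub 3 2).and ((MSOFormula.lt 0 3).and (MSOFormula.lt 3 1))).ex,
    fun _ => S, fun x y => ?_⟩
  constructor
  · rintro ⟨Z, h1, ⟨a, b, ha, hb, hab⟩, ⟨b', c, hb', hc, hbc⟩⟩
    have ha : ({x} : Set C) = {a} := ha
    have hb : Z = {b} := hb
    have hb' : Z = {b'} := hb'
    have hc : ({y} : Set C) = {c} := hc
    have h1 : Z ⊆ S := h1
    subst hb
    obtain rfl := Set.singleton_eq_singleton_iff.1 ha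
    obtain rfl := Set.singleton_eq_singleton_iff.1 hb'
    obtain rfl := Set.singleton_eq_singleton_iff.1 hc
    exact ⟨b, h1 rfl, hab, hbc⟩
  · rintro ⟨z, hz, h1, h2⟩
    exact ⟨{z}, Set.singleton_subset_iff.2 hz, ⟨x, z, rfl, rfl, h1⟩, ⟨z, y, rfl, rfl, h2⟩⟩

/-- No change of membership in `c` occurs between `x` and `y`. -/
def SameBlock (c : Set C) (x y : C) : Prop :=
  ∀ z ∈ Set.uIcc x y, (z ∈ c ↔ x ∈ c)

theorem isDefinableRel_sameBlock (c : Set C) : IsDefinableRel (SameBlock c) := by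
  have hb := isDefinableRel_exists_between c
  have hb' := isDefinableRel_exists_between cᶜ
  have hm := isDefinableRel_mem c
  have h1 := ((hm.and hm.swap).and hb'.not).and hb'.swap.not
  have h2 := ((hm.not.and hm.swap.not).and hb.not).and hb.swap.not
  -- Either both points lie in `c` with no point of the complement between them, or the same with
  -- `c` and its complement exchanged; both orders of the two points are covered.
  refine (h1.or h2).congr fun x y => ?_
  constructor
  · rintro (⟨⟨⟨hx, hy⟩, h1⟩, h2⟩ | ⟨⟨⟨hx, hy⟩, h1⟩, h2⟩) z hz
    · refine iff_of_true ?_ hx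
      by_contra hzc
      have hxz : z ≠ x := fun h => hzc (h ▸ hx)
      have hyz : z ≠ y := fun h => hzc (h ▸ hy)
      rcases Set.mem_uIcc.1 hz with ⟨ha, hb⟩ | ⟨ha, hb⟩
      · exact h1 ⟨z, hzc, lt_of_le_of_ne ha hxz.symm, lt_of_le_of_ne hb hyz⟩
      · exact h2 ⟨z, hzc, lt_of_le_of_ne ha hyz.symm, lt_of_le_of_ne hb hxz⟩
    · refine iff_of_false ?_ hx
      intro hzc
      have hxz : z ≠ x := fun h => hx (h ▸ hzc)
      have hyz : z ≠ y := fun h => hy (h ▸ hzc)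
      rcases Set.mem_uIcc.1 hz with ⟨ha, hb⟩ | ⟨ha, hb⟩
      · exact h1 ⟨z, hzc, lt_of_le_of_ne ha hxz.symm, lt_of_le_of_ne hb hyz⟩
      · exact h2 ⟨z, hzc, lt_of_le_of_ne ha hyz.symm, lt_of_le_of_ne hb hxz⟩
  · intro h
    by_cases hx : x ∈ c
    · refine Or.inl ⟨⟨⟨hx, (h y Set.right_mem_uIcc).2 hx⟩, ?_⟩, ?_⟩ <;> rintro ⟨z, hz, h1, h2⟩
      · exact hz ((h z (Set.mem_uIcc.2 (Or.inl ⟨h1.le, h2.le⟩))).2 hx)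
      · exact hz ((h z (Set.mem_uIcc.2 (Or.inr ⟨h1.le, h2.le⟩))).2 hx)
    · refine Or.inr ⟨⟨⟨hx, fun hy => hx ((h y Set.right_mem_uIcc).1 hy)⟩, ?_⟩, ?_⟩ <;>
        rintro ⟨z, hz, h1, h2⟩
      · exact hx ((h z (Set.mem_uIcc.2 (Or.inl ⟨h1.le, h2.le⟩))).1 hz)
      · exact hx ((h z (Set.mem_uIcc.2 (Or.inr ⟨h1.le, h2.le⟩))).1 hz)

/-- The order coded by `n` layers of nested blocks: the blocks of layer `n` are separated by the
colour `c n`, and `d n` marks the points where the order between these blocks is reversed. -/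
def layered (c d : ℕ → Set C) : ℕ → C → C → Prop
  | 0, x, y => x < y
  | n + 1, x, y => (SameBlock (c n) x y ∧ layered c d n x y) ∨
      (¬ SameBlock (c n) x y ∧ ((x ∈ d n ∧ y < x) ∨ (¬ x ∈ d n ∧ x < y)))

theorem isDefinableRel_layered (c d : ℕ → Set C) (n : ℕ) : IsDefinableRel (layered c d n) := by
  induction n with
  | zero => exact isDefinableRel_lt
  | succ n ih =>
    have hs := isDefinableRel_sameBlock (c n)
    have hd := isDefinableRel_mem (d n)
    exact (hs.and ih).or (hs.not.and ((hd.and isDefinableRel_lt.swap).or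
      (hd.not.and isDefinableRel_lt)))

theorem layered_congr {c d c' d' : ℕ → Set C} {n : ℕ} (hc : ∀ i < n, c i = c' i)
    (hd : ∀ i < n, d i = d' i) (x y : C) : layered c d n x y ↔ layered c' d' n x y := by
  induction n with
  | zero => exact Iff.rfl
  | succ n ih =>
    have := ih (fun i hi => hc i (by omega)) (fun i hi => hd i (by omega))
    simp only [layered, hc n (Nat.lt_succ_self n), hd n (Nat.lt_succ_self n), this]

/-- Convexity is needed because `SameBlock` inspects all intermediate points. -/
theorem layered_subtype {p : C → Prop} (hp : Set.OrdConnected {x | p x}) {c d : ℕ → Set C} {n : ℕ}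
    (x y : {x // p x}) :
    layered (fun i => ((↑) : {x // p x} → C) ⁻¹' c i) (fun i => ((↑) : {x // p x} → C) ⁻¹' d i) n
      x y ↔ layered c d n (x : C) (y : C) := by
  induction n with
  | zero => exact Iff.rfl
  | succ n ih =>
    have hs : SameBlock (((↑) : {x // p x} → C) ⁻¹' c n) x y ↔ SameBlock (c n) (x : C) y := by
      have hmem : ∀ z : {x // p x}, z ∈ Set.uIcc x y ↔ (z : C) ∈ Set.uIcc (x : C) y := fun z => by
        simp only [Set.mem_uIcc, ← Subtype.coe_le_coe]
      constructor
      · intro h z hz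
        exact h ⟨z, hp.uIcc_subset x.2 y.2 hz⟩ ((hmem _).2 hz)
      · intro h z hz
        exact h z ((hmem z).1 hz)
    exact or_congr (and_congr hs ih) (and_congr (not_congr hs) Iff.rfl)

end Definability

/-! ### A definable well-ordering of bounded size -/

section Construction

/-- `q` is false at points without a predecessor and flips at each successor, so it changes between
`i` and the successor of `i`. This lets one set of points separate all summands of an ordered sum.
-/
theorem exists_alternating_of_wellFoundedLT (I : Type*) [LinearOrder I] [WellFoundedLT I] :
    ∃ q : I → Prop, ∀ i j, i < j → ∃ k, i ≤ k ∧ k ≤ j ∧ ¬ (q k ↔ q i) := by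
  let q : I → Prop := IsWellFounded.fix (· < · : I → I → Prop)
    (fun j ih => ∃ i, ∃ h : i < j, (∀ k, k < j → k ≤ i) ∧ ¬ ih i h)
  have hq : ∀ j, q j ↔ ∃ i, i < j ∧ (∀ k, k < j → k ≤ i) ∧ ¬ q i := by
    intro j
    have := IsWellFounded.fix_eq (· < · : I → I → Prop)
      (fun j (ih : ∀ i, i < j → Prop) => ∃ i, ∃ h : i < j, (∀ k, k < j → k ≤ i) ∧ ¬ ih i h) j
    refine (iff_of_eq this).trans ?_
    simp only [exists_prop, q]
  refine ⟨q, fun i j hij => ?_⟩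
  have wf : WellFounded (· < · : I → I → Prop) := IsWellFounded.wf
  have hne : {k | i < k}.Nonempty := ⟨j, hij⟩
  have hm : i < wf.min _ hne := wf.min_mem _ hne
  have hmin : ∀ k, k < wf.min _ hne → k ≤ i := fun k hk => not_lt.1 fun h =>
    wf.not_lt_min {k | i < k} h hk
  refine ⟨wf.min _ hne, hm.le, not_lt.1 (wf.not_lt_min {k | i < k} hij), fun h => ?_⟩
  rw [hq] at h
  by_cases hi : q i
  · obtain ⟨i', h1, h2, h3⟩ := h.2 hi
    exact h3 (le_antisymm (h2 i hm) (hmin i' h1) ▸ hi)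
  · exact hi (h.1 ⟨i, hm, hmin, hi⟩)

theorem exists_alternating (I : Type*) [LinearOrder I] (hI : WellFoundedLT I ∨ WellFoundedGT I) :
    ∃ q : I → Prop, ∀ i j, i < j → ∃ k, i ≤ k ∧ k ≤ j ∧ ¬ (q k ↔ q i) := by
  rcases hI with hI | hI
  · exact exists_alternating_of_wellFoundedLT I
  · obtain ⟨q, hq⟩ := exists_alternating_of_wellFoundedLT Iᵒᵈ
    refine ⟨q, fun i j hij => ?_⟩
    by_cases h : q j ↔ q i
    · obtain ⟨k, h1, h2, h3⟩ := hq j i hij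
      exact ⟨k, h2, h1, fun h' => h3 (h'.trans h.symm)⟩
    · exact ⟨j, hij.le, le_rfl, h⟩

/-- No interval `[x i, x (i + 1))` fits into a single fibre, so `f` is strictly increasing along
`x`. -/
theorem Large.image_of_fibers {C I : Type*} {r : C → C → Prop} {s : I → I → Prop}
    [IsStrictTotalOrder C r] [IsStrictTotalOrder I s] {f : C → I}
    (hf : ∀ x y, r x y → ¬ s (f y) (f x)) {a : ℕ} (ha : ∀ i, ¬ Large r a {x | f x = i}) {k : ℕ}
    {S : Set C} (h : Large r (a + k) S) : Large s k (f '' S) := by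
  induction k generalizing S with
  | zero => exact h.nonempty.image f
  | succ k ih =>
    obtain ⟨x, hx, h⟩ := h
    have hf' : ∀ x y, ¬ r y x → ¬ s (f y) (f x) := by
      intro x y hxy
      rcases trichotomous_of r x y with h' | rfl | h'
      · exact hf _ _ h'
      · exact irrefl _
      · exact absurd h' hxy
    have hs : ∀ i, s (f (x i)) (f (x (i + 1))) := by
      intro i
      rcases trichotomous_of s (f (x i)) (f (x (i + 1))) with h' | h' | h'
      · exact h'
      · refine absurd (((h i).of_le (Nat.le_add_right a k)).mono ?_) (ha (f (x i)))
        rintro y ⟨-, h1, h2⟩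
        have h3 := hf' _ _ h1
        have h4 := hf _ _ h2
        rw [← h'] at h4
        rcases trichotomous_of s (f y) (f (x i)) with h5 | h5 | h5
        · exact absurd h5 h3
        · exact h5
        · exact absurd h5 h4
      · exact absurd h' (hf _ _ (hx i))
    -- An image of a point below `x (2 * i + 1)` may equal `f (x (2 * i + 1))`; taking every second
    -- point makes the upper bound strict.
    refine ⟨fun i => f (x (2 * i)), fun i => rel_of_lt (x := fun i => f (x i)) hs (i := 2 * i) (j := 2 * (i + 1)) (by omega),
      fun i => (ih (h (2 * i))).mono ?_⟩
    rintro _ ⟨y, ⟨hy, h1, h2⟩, rfl⟩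
    refine ⟨⟨y, hy, rfl⟩, hf' _ _ h1, ?_⟩
    by_contra h3
    exact not_rel_trans (hf _ _ h2) h3 (hs (2 * i + 1))

/-- The cut points in `Large` need not satisfy `p`; they are replaced by the least elements of the
blocks. -/
theorem Large.subtype {C : Type*} {r : C → C → Prop} [IsWellOrder C r] {p : C → Prop} {k : ℕ}
    {S : Set C} (h : Large r k S) (hS : ∀ x ∈ S, p x) :
    Large (fun x y : {x // p x} => r x y) k (((↑) : {x // p x} → C) ⁻¹' S) := by
  induction k generalizing S with
  | zero =>
    obtain ⟨x, hx⟩ := h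
    exact ⟨⟨x, hS x hx⟩, hx⟩
  | succ k ih =>
    obtain ⟨x, hx, h⟩ := h
    have wf : WellFounded r := IsWellFounded.wf
    have hmem := fun i => wf.min_mem _ (h i).nonempty
    refine ⟨fun i => ⟨wf.min _ (h i).nonempty, hS _ (hmem i).1⟩, fun i =>
      rel_of_rel_of_not (hmem i).2.2 (hmem (i + 1)).2.1, fun i =>
      (ih (h i) fun x hx => hS x hx.1).mono ?_⟩
    intro z hz
    exact ⟨hz.1, wf.not_lt_min {y | y ∈ S ∧ ¬ r y (x i) ∧ r y (x (i + 1))} hz,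
      rel_of_rel_of_not hz.2.2 (hmem (i + 1)).2.1⟩

theorem isWellOrder_of_fibers {C I : Type*} {r : C → C → Prop} {s : I → I → Prop} [IsWellOrder I s]
    {f : C → I} (hfib : ∀ i, IsWellOrder {x // f x = i} (fun x y => r x y))
    (hr : ∀ x y, f x ≠ f y → (r x y ↔ s (f x) (f y))) : IsWellOrder C r := by
  have hs : ∀ x y, r x y → f x ≠ f y → s (f x) (f y) := fun x y h hne => (hr x y hne).1 h
  refine { wf := ?_, trichotomous := ?_ }
  · rw [WellFounded.wellFounded_iff_has_min]
    intro S hS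
    have wf : WellFounded s := IsWellFounded.wf
    obtain ⟨x, hx, hxi⟩ := wf.min_mem _ (hS.image f)
    set i := wf.min _ (hS.image f)
    have hne : {y : {x // f x = i} | (y : C) ∈ S}.Nonempty := ⟨⟨x, hxi⟩, hx⟩
    have wf' : WellFounded (fun x y : {x // f x = i} => r x y) := (hfib i).wf
    refine ⟨wf'.min _ hne, wf'.min_mem _ hne, fun y hy hlt => ?_⟩
    by_cases hyi : f y = i
    · exact wf'.not_lt_min {y : {x // f x = i} | (y : C) ∈ S} (x := ⟨y, hyi⟩) hy hlt
    · have h1 : f (wf'.min _ hne : C) = i := (wf'.min _ hne).2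
      have h2 := hs _ _ hlt (by rw [h1]; exact hyi)
      rw [h1] at h2
      exact wf.not_lt_min (f '' S) ⟨y, hy, rfl⟩ h2
  · intro x y h1 h2
    by_cases hxy : f x = f y
    · have := (hfib (f x)).trichotomous ⟨x, rfl⟩ ⟨y, hxy.symm⟩ h1 h2
      exact congrArg Subtype.val this
    · rcases trichotomous_of s (f x) (f y) with h | h | h
      · exact absurd ((hr x y hxy).2 h) h1
      · exact absurd h hxy
      · exact absurd ((hr y x (Ne.symm hxy)).2 h) h2

theorem exists_layered_isWellOrder (n : ℕ) : ∀ (C : Type u) [LinearOrder C], HausdorffDegreeLE n C →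
    ∃ c d : ℕ → Set C, IsWellOrder C (layered c d n) ∧
      ∀ k, Large (layered c d n) (n * k + 1) Set.univ →
        Large (fun x y : C => x < y) k Set.univ ∨ Large (fun x y : C => y < x) k Set.univ := by
  induction n with
  | zero =>
    intro C _ hC
    have : Finite C := hC
    have : IsWellOrder C (fun x y : C => x < y) := { }
    refine ⟨fun _ => ∅, fun _ => ∅, this, fun k h => ?_⟩
    rw [Nat.zero_mul, Nat.zero_add] at h
    exact absurd Set.finite_univ (Large.not_finite (r := fun x y : C => x < y) h)
  | succ n ih =>
    rintro C _ ⟨I, _, hI, f, hf, hfib⟩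
    choose c' d' hwo hlarge using fun i => ih _ (hfib i)
    -- Every index in the range is attained, so a change of `q` between two indices is seen at a
    -- point of `C`.
    let g : C → Set.range f := Set.rangeFactorization f
    have hg : Monotone g := fun x y h => hf h
    have hR : WellFoundedLT (Set.range f) ∨ WellFoundedGT (Set.range f) := by
      rcases hI with hI | hI
      · exact Or.inl inferInstance
      · exact Or.inr inferInstance
    obtain ⟨q, hq⟩ := exists_alternating (Set.range f) hR
    classical
    let D : Set C := if WellFoundedLT (Set.range f) then ∅ else Set.univ
    -- The colours of all the fibres at layer `m < n` are glued into one set; thus the number of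
    -- parameters depends on the degree alone, and the directions, glued in `d`, may vary from fibre
    -- to fibre.
    let c : ℕ → Set C := fun m => if m < n then {x | (⟨x, rfl⟩ : {y // f y = f x}) ∈ c' (f x) m}
      else {x | q (g x)}
    let d : ℕ → Set C := fun m => if m < n then {x | (⟨x, rfl⟩ : {y // f y = f x}) ∈ d' (f x) m}
      else D
    have hcn : c n = {x | q (g x)} := if_neg (lt_irrefl n)
    have hdn : d n = D := if_neg (lt_irrefl n)
    have hsame : ∀ x y, SameBlock (c n) x y ↔ f x = f y := by
      have one : ∀ x y, x ≤ y → f x ≠ f y →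
          ∃ z ∈ Set.Icc x y, ¬ (q (g z) ↔ q (g x)) := by
        intro x y hxy hne
        have hlt : g x < g y := lt_of_le_of_ne (hg hxy) fun h => hne (congrArg Subtype.val h)
        obtain ⟨⟨_, z, rfl⟩, h1, h2, h3⟩ := hq _ _ hlt
        have h1' : f x ≤ f z := h1
        have h2' : f z ≤ f y := h2
        by_cases hzx : z < x
        · have : f z = f x := le_antisymm (hf hzx.le) h1'
          exact absurd (by rw [show (⟨f z, z, rfl⟩ : Set.range f) = g x from Subtype.ext this]) h3
        by_cases hyz : y < z
        · have : f z = f y := le_antisymm h2' (hf hyz.le)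
          refine ⟨y, ⟨hxy, le_rfl⟩, ?_⟩
          rwa [show (⟨f z, z, rfl⟩ : Set.range f) = g y from Subtype.ext this] at h3
        · exact ⟨z, ⟨not_lt.1 hzx, not_lt.1 hyz⟩, h3⟩
      intro x y
      rw [hcn]
      constructor
      · intro h
        by_contra hne
        rcases le_total x y with hxy | hxy
        · obtain ⟨z, hz, hzq⟩ := one x y hxy hne
          exact hzq (h z (Set.mem_uIcc_of_le hz.1 hz.2))
        · obtain ⟨z, hz, hzq⟩ := one y x hxy (Ne.symm hne)
          exact hzq ((h z (Set.mem_uIcc_of_ge hz.1 hz.2)).trans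
            (h y Set.right_mem_uIcc).symm)
      · intro h z hz
        have : g z = g x := by
          apply Subtype.ext
          change f z = f x
          rcases Set.mem_uIcc.1 hz with ⟨h1, h2⟩ | ⟨h1, h2⟩
          · exact le_antisymm ((hf h2).trans h.ge) (hf h1)
          · exact le_antisymm (hf h2) (h.le.trans (hf h1))
        change q (g z) ↔ q (g x)
        rw [this]
    have hconv : ∀ i, Set.OrdConnected {x | f x = i} := by
      intro i
      refine ⟨?_⟩
      rintro x hx y hy z ⟨h1, h2⟩
      have hx : f x = i := hx
      have hy : f y = i := hy
      exact le_antisymm (hy ▸ hf h2) (hx ▸ hf h1)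
    have hin : ∀ i, ∀ x y : {x // f x = i}, layered c d (n + 1) (x : C) (y : C) ↔
        layered (c' i) (d' i) n x y := by
      intro i x y
      have h1 : layered c d (n + 1) (x : C) (y : C) ↔ layered c d n (x : C) (y : C) := by
        have h2 : SameBlock (c n) (x : C) (y : C) := (hsame _ _).2 (x.2.trans y.2.symm)
        simp only [layered, h2, true_and, not_true_eq_false, false_and, or_false]
      rw [h1, ← layered_subtype (hconv i) x y]
      apply layered_congr
      · intro m hm
        ext ⟨z, rfl⟩
        simp only [c, if_pos hm]
        exact Iff.rfl
      · intro m hm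
        ext ⟨z, rfl⟩
        simp only [d, if_pos hm]
        exact Iff.rfl
    have hfibwo : ∀ i, IsWellOrder {x // f x = i} (fun x y => layered c d (n + 1) x y) := by
      intro i
      have : (fun x y : {x // f x = i} => layered c d (n + 1) (x : C) (y : C)) =
          layered (c' i) (d' i) n := by
        funext x y; exact propext (hin i x y)
      rw [this]
      exact hwo i
    have main : ∀ (s : Set.range f → Set.range f → Prop) [IsWellOrder (Set.range f) s],
        (∀ x y, g x ≠ g y → (layered c d (n + 1) x y ↔ s (g x) (g y))) →
        (∀ k, Large s k Set.univ →
        Large (fun x y : C => x < y) k Set.univ ∨ Large (fun x y : C => y < x) k Set.univ) →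
        IsWellOrder C (layered c d (n + 1)) ∧
        ∀ k, Large (layered c d (n + 1)) ((n + 1) * k + 1) Set.univ →
        Large (fun x y : C => x < y) k Set.univ ∨ Large (fun x y : C => y < x) k Set.univ := by
      intro s _ hs hls
      have hwo' : IsWellOrder C (layered c d (n + 1)) := by
        refine isWellOrder_of_fibers (f := g) (s := s) ?_ hs
        rintro ⟨i, hi⟩
        have hgi : ∀ x, g x = ⟨i, hi⟩ ↔ f x = i := fun x =>
          ⟨fun h => congrArg Subtype.val h, fun h => Subtype.ext h⟩
        have := hfibwo i
        let emb : {x // g x = ⟨i, hi⟩} → {x // f x = i} := fun x => ⟨x, (hgi x).1 x.2⟩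
        have hemb : Function.Injective emb := fun x y h =>
          Subtype.ext (congrArg (fun z : {x // f x = i} => (z : C)) h)
        exact (RelEmbedding.preimage ⟨emb, hemb⟩
          (fun x y : {x // f x = i} => layered c d (n + 1) x y)).isWellOrder
      refine ⟨hwo', fun k hk => ?_⟩
      -- Since `(n + 1) * k + 1 = (n * k + 1) + k`, either some fibre has size `ω ^ (n * k + 1)` and
      -- the induction hypothesis applies, or the index chain itself has size `ω ^ k`.
      by_cases hex : ∃ i, Large (layered c d (n + 1)) (n * k + 1) {x | g x = i}
      · obtain ⟨⟨i, hi⟩, hl⟩ := hex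
        have := hfibwo i
        have hl' : Large (layered (c' i) (d' i) n) (n * k + 1) Set.univ := by
          have hpull := hl.subtype (p := fun x => f x = i)
            fun x (hx : g x = ⟨i, hi⟩) => congrArg Subtype.val hx
          rw [show (fun x y : {x // f x = i} => layered c d (n + 1) (x : C) (y : C)) =
            layered (c' i) (d' i) n from funext₂ fun x y => propext (hin i x y)] at hpull
          exact hpull.mono (Set.subset_univ _)
        rcases hlarge i k hl' with h | h
        · exact Or.inl ((h.image (s := fun x y : C => x < y)
            (fun x : {x // f x = i} => (x : C)) fun x y => Iff.rfl).mono (Set.subset_univ _))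
        · exact Or.inr ((h.image (s := fun x y : C => y < x)
            (fun x : {x // f x = i} => (x : C)) fun x y => Iff.rfl).mono (Set.subset_univ _))
      · push Not at hex
        have hl : Large (layered c d (n + 1)) ((n * k + 1) + k) Set.univ := by
          convert hk using 1; ring
        refine hls k ((Large.image_of_fibers (s := s) (f := g) ?_ hex hl).mono
          (Set.subset_univ _))
        intro x y hxy h
        have hne : g x ≠ g y := fun h' => irrefl _ (h' ▸ h : s (g x) (g x))
        exact asymm ((hs x y hne).1 hxy) h
    let sec : Set.range f → C := fun i => i.2.choose
    have hsec : ∀ i j, i < j ↔ sec i < sec j := by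
      have one : ∀ i j, i < j → sec i < sec j := by
        intro i j hij
        by_contra! h
        have := hf h
        rw [i.2.choose_spec, j.2.choose_spec] at this
        exact absurd hij (not_lt.2 this)
      intro i j
      refine ⟨one i j, fun h => ?_⟩
      rcases lt_trichotomy i j with h' | rfl | h'
      · exact h'
      · exact absurd h (lt_irrefl _)
      · exact absurd h (lt_asymm (one j i h'))
    have hlt : ∀ x y, g x ≠ g y → (x < y ↔ g x < g y) := by
      intro x y hne
      constructor
      · exact fun h => lt_of_le_of_ne (hg h.le) hne
      · intro h
        by_contra! h'
        exact absurd h (not_lt.2 (hg h'))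
    refine ⟨c, d, ?_⟩
    by_cases hwf : WellFoundedLT (Set.range f)
    · have : IsWellOrder (Set.range f) (fun i j => i < j) := { }
      refine main (fun i j => i < j) (fun x y hne => ?_) fun k h =>
        Or.inl ((h.image sec hsec).mono (Set.subset_univ _))
      have h1 : ¬ SameBlock (c n) x y := fun h => hne (Subtype.ext ((hsame _ _).1 h))
      rw [← hlt x y hne]
      simp only [layered, h1, hdn, D, if_pos hwf]
      simp
    · have : WellFoundedGT (Set.range f) := hR.resolve_left hwf
      have : IsWellOrder (Set.range f) (fun i j => j < i) := {
        wf := this.wf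
        trichotomous := fun i j h1 h2 => le_antisymm (not_lt.1 h1) (not_lt.1 h2) }
      refine main (fun i j => j < i) (fun x y hne => ?_) fun k h =>
        Or.inr ((h.image sec (fun i j => hsec j i)).mono (Set.subset_univ _))
      have h1 : ¬ SameBlock (c n) x y := fun h => hne (Subtype.ext ((hsame _ _).1 h))
      rw [← hlt y x (Ne.symm hne)]
      simp only [layered, h1, hdn, D, if_neg hwf]
      simp

end Construction

/-! ### Arithmetic below `ω ^ ω` -/

section OrdinalArithmetic

open Ordinal

theorem add_omega0_pow {a : Ordinal.{0}} {n : ℕ} (h : a < ω ^ n) : a + ω ^ n = ω ^ n := by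
  rw [← opow_natCast] at h ⊢
  exact add_omega0_opow h

theorem add_lt_omega0_pow {a b : Ordinal.{0}} {n : ℕ} (ha : a < ω ^ n) (hb : b < ω ^ n) :
    a + b < ω ^ n := by
  calc a + b < a + ω ^ n := (add_lt_add_iff_left a).2 hb
    _ = ω ^ n := add_omega0_pow ha

theorem omega0_pow_lt {j l : ℕ} (h : j < l) : (ω ^ j : Ordinal.{0}) < ω ^ l :=
  pow_lt_pow_right₀ one_lt_omega0 h

theorem omega0_pow_pos' (n : ℕ) : (0 : Ordinal.{0}) < ω ^ n := pow_pos omega0_pos n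

theorem omega0_pow_mul_lt (n i : ℕ) : (ω ^ n * i : Ordinal.{0}) < ω ^ (n + 1) := by
  rw [pow_succ]
  exact (mul_lt_mul_iff_right₀ (omega0_pow_pos' n)).2 (natCast_lt_omega0 i)

theorem exists_eq_omega0_pow_mul_add {a : Ordinal.{0}} {n : ℕ} (h : a < ω ^ (n + 1)) :
    ∃ (i : ℕ) (b : Ordinal.{0}), b < ω ^ n ∧ a = ω ^ n * i + b := by
  have hn := (omega0_pow_pos' n).ne'
  have h1 : a / ω ^ n < ω := by
    rw [← Ordinal.lt_mul_iff_div_lt hn, ← pow_succ]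
    exact h
  obtain ⟨i, hi⟩ := lt_omega0.1 h1
  exact ⟨i, a % ω ^ n, mod_lt _ hn, by rw [← hi, div_add_mod]⟩

theorem omega0_pow_mul_succ (n i : ℕ) :
    (ω ^ n * (i + 1 : ℕ) : Ordinal.{0}) = ω ^ n * i + ω ^ n := by
  rw [Nat.cast_succ, mul_add_one]

theorem lt_of_omega0_pow_mul_add_lt {n i j : ℕ} {b c : Ordinal.{0}} (hb : b < ω ^ n)
    (h : ω ^ n * (j : Ordinal.{0}) + c < ω ^ n * i + b) : j < i ∨ j = i ∧ c < b := by
  rcases lt_trichotomy j i with hlt | rfl | hlt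
  · exact Or.inl hlt
  · exact Or.inr ⟨rfl, (add_lt_add_iff_left _).1 h⟩
  · exfalso
    have h1 : (ω ^ n * i + b : Ordinal.{0}) < ω ^ n * (i + 1 : ℕ) := by
      rw [omega0_pow_mul_succ]
      exact (add_lt_add_iff_left _).2 hb
    have h2 : (ω ^ n * (i + 1 : ℕ) : Ordinal.{0}) ≤ ω ^ n * j :=
      mul_le_mul_right (Nat.cast_le.2 hlt) _
    exact absurd (h.trans (h1.trans_le (h2.trans le_self_add))) (lt_irrefl _)

/-- `ω ^ r` is the last term of the Cantor normal form. -/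
theorem exists_eq_add_omega0_pow {N : ℕ} {ζ : Ordinal.{0}} (h0 : ζ ≠ 0) (h : ζ < ω ^ N) :
    ∃ (η : Ordinal.{0}) (r : ℕ), r < N ∧ ζ = η + ω ^ r := by
  induction N generalizing ζ with
  | zero => exact absurd (by simpa using h) h0
  | succ N ih =>
    obtain ⟨i, b, hb, rfl⟩ := exists_eq_omega0_pow_mul_add h
    by_cases hb0 : b = 0
    · subst hb0
      rcases i with _ | i
      · simp at h0
      · exact ⟨ω ^ N * i, N, Nat.lt_succ_self N, by rw [add_zero, omega0_pow_mul_succ]⟩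
    · obtain ⟨η, r, hr, rfl⟩ := ih hb0 hb
      exact ⟨ω ^ N * i + η, r, by omega, by rw [add_assoc]⟩

/-- With `ζ = ω ^ l * i + b`: for `i > 0` the summand `ω ^ j` is absorbed while `ω ^ l` raises the
coefficient; for `i = 0` the left side is still below `ω ^ l`. -/
theorem omega0_pow_add_lt {j l : ℕ} (hjl : j < l) {ζ : Ordinal.{0}} (h : ζ < ω ^ (l + 1)) :
    ω ^ j + ζ < ω ^ l + ζ := by
  obtain ⟨i, b, hb, rfl⟩ := exists_eq_omega0_pow_mul_add h
  have hj := omega0_pow_lt hjl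
  rcases i with _ | i
  · rw [Nat.cast_zero, mul_zero, zero_add]
    exact (add_lt_omega0_pow hj hb).trans_le le_self_add
  · have h1 : ∀ i : ℕ, (ω ^ l * (i + 1 : ℕ) : Ordinal.{0}) = ω ^ l + ω ^ l * i := fun i => by
      rw [Nat.add_comm i 1, Nat.cast_add, Nat.cast_one, mul_add, mul_one]
    have h2 : (ω ^ j + ω ^ l * (i + 1 : ℕ) : Ordinal.{0}) = ω ^ l * (i + 1 : ℕ) := by
      rw [h1, ← add_assoc, add_omega0_pow hj]
    have h3 : (ω ^ l + ω ^ l * (i + 1 : ℕ) : Ordinal.{0}) = ω ^ l * (i + 1 : ℕ) + ω ^ l := by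
      rw [← h1, omega0_pow_mul_succ]
    rw [← add_assoc, h2, ← add_assoc, h3, add_assoc]
    refine (add_lt_add_iff_left _).2 (hb.trans_le le_self_add)

end OrdinalArithmetic

/-! ### Ladders and their definability -/

section Ladders

variable {C : Type u} [LinearOrder C]

/-- `X` is a cofinal subset of `Y` in which every element of `Y` has a last predecessor, if any. -/
def IsLadder (X Y : Set C) : Prop :=
  X ⊆ Y ∧ (∀ y ∈ Y, ∃ x ∈ X, y < x) ∧
    ∀ y ∈ Y, (∃ x ∈ X, x < y) → ∃ x ∈ X, x < y ∧ ∀ x' ∈ X, ¬ (x < x' ∧ x' < y)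

namespace MSOFormula

/-- The formula saying that `X_i` is a ladder of `X_j`. -/
def ladder {n : ℕ} (i j : Fin n) : MSOFormula n :=
  (sub i j).and
    ((((sing (Fin.last n)).and ((sub (Fin.last n) j.castSucc).and
      ((sub (Fin.last (n + 1)) i.castSucc.castSucc).and
        (lt (Fin.last n).castSucc (Fin.last (n + 1)))).ex.neg)).ex.neg).and
    ((((sub (Fin.last n) j.castSucc).and
      (((sub (Fin.last (n + 1)) i.castSucc.castSucc).and
        (lt (Fin.last (n + 1)) (Fin.last n).castSucc)).ex.and
      (((sub (Fin.last (n + 1)) i.castSucc.castSucc).and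
        ((lt (Fin.last (n + 1)) (Fin.last n).castSucc).and
        ((sub (Fin.last (n + 2)) i.castSucc.castSucc.castSucc).and
          ((lt (Fin.last (n + 1)).castSucc (Fin.last (n + 2))).and
          (lt (Fin.last (n + 2)) (Fin.last n).castSucc.castSucc))).ex.neg)).ex.neg))).ex.neg)))

theorem holds_ladder {n : ℕ} (i j : Fin n) (A : Fin n → Set C) :
    (ladder i j).Holds A ↔ IsLadder (A i) (A j) := by
  have e1 : ∀ (y : C) (X : Set C), (∃ B : Set C, B ⊆ X ∧ ∃ a b, {y} = ({a} : Set C) ∧ B = {b} ∧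
      a < b) ↔ ∃ x ∈ X, y < x := by
    intro y X
    constructor
    · rintro ⟨_, hB, a, b, ha, rfl, hab⟩
      obtain rfl := Set.singleton_eq_singleton_iff.1 ha
      exact ⟨b, hB rfl, hab⟩
    · rintro ⟨x, hx, h⟩
      exact ⟨{x}, Set.singleton_subset_iff.2 hx, y, x, rfl, rfl, h⟩
  have e2 : ∀ (y : C) (X : Set C) (p : Set C → Prop), (∃ B : Set C, B ⊆ X ∧
      (∃ a b, B = {a} ∧ ({y} : Set C) = {b} ∧ a < b) ∧ p B) ↔ ∃ x ∈ X, x < y ∧ p {x} := by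
    intro y X p
    constructor
    · rintro ⟨_, hB, ⟨a, b, rfl, hb, hab⟩, hp⟩
      obtain rfl := Set.singleton_eq_singleton_iff.1 hb
      exact ⟨a, hB rfl, hab, hp⟩
    · rintro ⟨x, hx, h, hp⟩
      exact ⟨{x}, Set.singleton_subset_iff.2 hx, ⟨x, y, rfl, rfl, h⟩, hp⟩
  have e3 : ∀ (x y : C) (X : Set C), (∃ B : Set C, B ⊆ X ∧
      (∃ a b, ({x} : Set C) = {a} ∧ B = {b} ∧ a < b) ∧
      (∃ a b, B = {a} ∧ ({y} : Set C) = {b} ∧ a < b)) ↔ ∃ x' ∈ X, x < x' ∧ x' < y := by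
    intro x y X
    constructor
    · rintro ⟨_, hB, ⟨a, b, ha, rfl, hab⟩, ⟨c, e, hc, he, hce⟩⟩
      obtain rfl := Set.singleton_eq_singleton_iff.1 ha
      obtain rfl := Set.singleton_eq_singleton_iff.1 hc
      obtain rfl := Set.singleton_eq_singleton_iff.1 he
      exact ⟨b, hB rfl, hab, hce⟩
    · rintro ⟨x', hx, h1, h2⟩
      exact ⟨{x'}, Set.singleton_subset_iff.2 hx, ⟨x, x', rfl, rfl, h1⟩, ⟨x', y, rfl, rfl, h2⟩⟩
  have e4 : ∀ (y : C) (X : Set C), (∃ B : Set C, B ⊆ X ∧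
      (∃ a b, B = {a} ∧ ({y} : Set C) = {b} ∧ a < b)) ↔ ∃ x ∈ X, x < y := by
    intro y X
    simp
  simp only [ladder, Holds, Fin.snoc_last, Fin.snoc_castSucc, IsLadder]
  refine and_congr Iff.rfl (and_congr ?_ ?_)
  · constructor
    · intro h y hy
      by_contra hno
      exact h ⟨{y}, ⟨y, rfl⟩, Set.singleton_subset_iff.2 hy, fun h' => hno ((e1 y _).1 h')⟩
    · rintro h ⟨_, ⟨y, rfl⟩, hy, hno⟩
      exact hno ((e1 y _).2 (h y (Set.singleton_subset_iff.1 hy)))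
  · have e5 : ∀ y, (∃ B : Set C, B ⊆ A i ∧
        (∃ a b, B = {a} ∧ ({y} : Set C) = {b} ∧ a < b) ∧
        ¬ ∃ B' : Set C, B' ⊆ A i ∧ (∃ a b, B = {a} ∧ B' = {b} ∧ a < b) ∧
          (∃ a b, B' = {a} ∧ ({y} : Set C) = {b} ∧ a < b)) ↔
        ∃ x ∈ A i, x < y ∧ ∀ x' ∈ A i, ¬ (x < x' ∧ x' < y) := by
      intro y
      rw [e2 y (A i) (fun B => ¬ ∃ B' : Set C, B' ⊆ A i ∧
        (∃ a b, B = {a} ∧ B' = {b} ∧ a < b) ∧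
          (∃ a b, B' = {a} ∧ ({y} : Set C) = {b} ∧ a < b))]
      simp only [e3, not_exists, not_and]
    constructor
    · intro h y hy hx
      by_contra hno
      exact h ⟨{y}, Set.singleton_subset_iff.2 hy, (e4 y _).2 hx, fun h' => hno ((e5 y).1 h')⟩
    · rintro h ⟨Y, hy, hx, hno⟩
      -- This clause of the formula has no `sing`, since the atom `lt` already forces singletons.
      obtain ⟨B, hB, a, y, rfl, rfl, hay⟩ := hx
      exact hno ((e5 y).2 (h y (Set.singleton_subset_iff.1 hy) ((e4 y _).1 ⟨{a}, hB, a, y, rfl,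
        rfl, hay⟩)))

end MSOFormula

end Ladders

/-! ### Sequences of length `ω ^ n` with uniform gaps -/

section Ladders

open Ordinal in
/-- Concatenation of `ω` many sequences of length `ω ^ n`. -/
noncomputable def concatSeq {C : Type u} (n : ℕ) (E : ℕ → Ordinal.{0} → C) (β : Ordinal.{0}) : C :=
  E (Function.invFun (fun i : ℕ => (i : Ordinal.{0})) (β / ω ^ n)) (β % ω ^ n)

open Ordinal in
theorem concatSeq_apply {C : Type u} {n : ℕ} (E : ℕ → Ordinal.{0} → C) (i : ℕ) {b : Ordinal.{0}}
    (hb : b < ω ^ n) : concatSeq n E (ω ^ n * i + b) = E i b := by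
  have hn := (omega0_pow_pos' n).ne'
  have hinv : Function.invFun (fun i : ℕ => (i : Ordinal.{0})) (i : Ordinal.{0}) = i :=
    Function.leftInverse_invFun (f := fun i : ℕ => (i : Ordinal.{0}))
      (fun a b h => Nat.cast_injective h) i
  rw [concatSeq, mul_add_div _ hn, div_eq_zero_of_lt hb, add_zero, hinv, mul_add_mod_self,
    mod_eq_of_lt hb]

variable {C : Type u} [LinearOrder C]

open Ordinal

/-- The part of the chain between the points `e β'`, `β' < β`, and the point `e β`. -/
def gap (e : Ordinal.{0} → C) (β : Ordinal.{0}) : Set C :=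
  {z | z < e β ∧ ∀ β' < β, e β' ≤ z}

/-- The set consisting of the point enumerated immediately before stage `β`, if any. -/
def predPoint (e : Ordinal.{0} → C) (β : Ordinal.{0}) : Set C :=
  {z | ∃ β', β' + 1 = β ∧ z = e β'}

/-- The type of the tuple `(X, Y, Q)` in `S`. -/
def pairType (d : ℕ) {k : ℕ} (Q : Fin k → Set C) (S X Y : Set C) : MSOType d (k + 2) :=
  mtype d S (Fin.cons X (Fin.cons Y Q : Fin (k + 1) → Set C) : Fin (k + 2) → Set C)

/-- The types of a gap, when the preceding point is marked once or twice. -/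
def gapType (d : ℕ) {k : ℕ} (Q : Fin k → Set C) (e : Ordinal.{0} → C) (β : Ordinal.{0}) :
    MSOType d (k + 2) × MSOType d (k + 2) :=
  (pairType d Q (gap e β) ∅ (predPoint e β), pairType d Q (gap e β) (predPoint e β) (predPoint e β))

theorem pairType_congr {d k : ℕ} {Q : Fin k → Set C} {S X X' Y Y' : Set C}
    (hX : X ∩ S = X' ∩ S) (hY : Y ∩ S = Y' ∩ S) : pairType d Q S X Y = pairType d Q S X' Y' :=
  mtype_cons_congr hX hY

section Concat

variable {n : ℕ} {E : ℕ → Ordinal.{0} → C}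

theorem concatSeq_lt (hE : ∀ i, StrictMonoOn (E i) (Set.Iio (ω ^ n)))
    (hEE : ∀ i j, i < j → ∀ b < ω ^ n, ∀ c < ω ^ n, E i b < E j c) {i j : ℕ} {b c : Ordinal.{0}}
    (hb : b < ω ^ n) (hc : c < ω ^ n) (h : ω ^ n * (j : Ordinal.{0}) + c < ω ^ n * i + b) :
    E j c < E i b := by
  rcases lt_of_omega0_pow_mul_add_lt hb h with hij | ⟨rfl, hcb⟩
  · exact hEE j i hij c hc b hb
  · exact hE j hc hb hcb

theorem concatSeq_strictMonoOn (hE : ∀ i, StrictMonoOn (E i) (Set.Iio (ω ^ n)))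
    (hEE : ∀ i j, i < j → ∀ b < ω ^ n, ∀ c < ω ^ n, E i b < E j c) :
    StrictMonoOn (concatSeq n E) (Set.Iio (ω ^ (n + 1))) := by
  intro β hβ γ hγ h
  obtain ⟨j, c, hc, rfl⟩ := exists_eq_omega0_pow_mul_add hβ
  obtain ⟨i, b, hb, rfl⟩ := exists_eq_omega0_pow_mul_add hγ
  rw [concatSeq_apply E _ hb, concatSeq_apply E _ hc]
  exact concatSeq_lt hE hEE hb hc h

theorem gap_concatSeq_iff
    (hEE : ∀ i j, i < j → ∀ b < ω ^ n, ∀ c < ω ^ n, E i b < E j c) {i : ℕ} {b : Ordinal.{0}}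
    (hb0 : 0 < b) (hb : b ≤ ω ^ n) (z : C) :
    (∀ β' < ω ^ n * i + b, concatSeq n E β' ≤ z) ↔ ∀ b' < b, E i b' ≤ z := by
  constructor
  · intro h b' hb'
    rw [← concatSeq_apply E i (hb'.trans_le hb)]
    exact h _ ((add_lt_add_iff_left _).2 hb')
  · intro h β' hβ'
    have hlt : β' < ω ^ (n + 1) := by
      refine hβ'.trans_le ?_
      calc (ω ^ n * i + b : Ordinal.{0}) ≤ ω ^ n * i + ω ^ n := add_le_add_right hb _
        _ = ω ^ n * (i + 1 : ℕ) := (omega0_pow_mul_succ n i).symm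
        _ ≤ _ := (omega0_pow_mul_lt n _).le
    obtain ⟨j, c, hc, rfl⟩ := exists_eq_omega0_pow_mul_add hlt
    rw [concatSeq_apply E _ hc]
    have hji : j < i ∨ j = i := by
      by_contra! hcon
      have hij : i < j := lt_of_le_of_ne hcon.1 hcon.2.symm
      have h1 : (ω ^ n * (i + 1 : ℕ) : Ordinal.{0}) ≤ ω ^ n * j :=
        mul_le_mul_right (Nat.cast_le.2 hij) _
      rw [omega0_pow_mul_succ] at h1
      exact absurd (hβ'.trans_le ((add_le_add_right hb _).trans h1)) (not_lt.2 le_self_add)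
    rcases hji with hji | rfl
    · exact (hEE j i hji c hc 0 (omega0_pow_pos' n)).le.trans (h 0 hb0)
    · exact h c ((add_lt_add_iff_left _).1 hβ')

theorem predPoint_concatSeq {C : Type u} {n : ℕ} {E : ℕ → Ordinal.{0} → C} {i : ℕ} {b : Ordinal.{0}} (hb0 : 0 < b) (hb : b ≤ ω ^ n) :
    predPoint (concatSeq n E) (ω ^ n * i + b) = {z | ∃ b', b' + 1 = b ∧ z = E i b'} := by
  ext z
  constructor
  · rintro ⟨β', hβ', rfl⟩
    have h1 : (ω ^ n * i : Ordinal.{0}) ≤ β' := by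
      rw [← Order.lt_add_one_iff, hβ']
      exact lt_add_of_pos_right _ hb0
    obtain ⟨b', rfl⟩ : ∃ b', β' = ω ^ n * i + b' := ⟨_, (Ordinal.add_sub_cancel_of_le h1).symm⟩
    rw [add_assoc] at hβ'
    have h2 : b' + 1 = b := (add_right_inj _).1 hβ'
    refine ⟨b', h2, concatSeq_apply E i ?_⟩
    exact lt_of_lt_of_le (Order.lt_add_one_iff.2 le_rfl) (h2.trans_le hb)
  · rintro ⟨b', rfl, rfl⟩
    refine ⟨ω ^ n * i + b', by rw [add_assoc], (concatSeq_apply E i ?_).symm⟩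
    exact lt_of_lt_of_le (Order.lt_add_one_iff.2 le_rfl) hb

end Concat

/-- Inside every set of order type at least `ω ^ n` there is a sequence of length `ω ^ n` in which
the type of a gap depends only on the rank of its position. -/
theorem exists_uniform_seq (d : ℕ) {k : ℕ} (Q : Fin k → Set C) (n : ℕ) : ∀ S : Set C,
    Large (fun x y : C => x < y) n S → ∃ (e : Ordinal.{0} → C)
      (σ : ℕ → MSOType d (k + 2) × MSOType d (k + 2)), StrictMonoOn e (Set.Iio (ω ^ n)) ∧
      (∀ β < ω ^ n, e β ∈ S) ∧ ∀ r < n, ∀ α, α + ω ^ r < ω ^ n → gapType d Q e (α + ω ^ r) = σ r := by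
  induction n with
  | zero =>
    rintro S ⟨x, hx⟩
    refine ⟨fun _ => x, fun _ => gapType d Q (fun _ => x) 0, ?_, fun _ _ => hx,
      fun r hr => absurd hr (Nat.not_lt_zero r)⟩
    intro a ha b hb hab
    rw [Set.mem_Iio, pow_zero, Order.lt_one_iff] at ha hb
    rw [ha, hb] at hab
    exact absurd hab (lt_irrefl _)
  | succ n ih =>
    rintro S ⟨x, hx, h⟩
    choose E σ hE hES hσ using fun i => ih _ (h i)
    -- `G i j` is the gap between the end of the sequence `E i` and the start of `E j`; `P i` is the
    -- last point of `E i`, which exists only for `n = 0`. Ramsey's theorem makes these types and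
    -- the `σ i` constant.
    let G : ℕ → ℕ → Set C := fun i j => {z | z < E j 0 ∧ ∀ b' < ω ^ n, E i b' ≤ z}
    let P : ℕ → Set C := fun i => {z | ∃ b', b' + 1 = (ω ^ n : Ordinal.{0}) ∧ z = E i b'}
    obtain ⟨f, c, hf, hc⟩ := exists_strictMono_homogeneous
      (α := (Fin n → MSOType d (k + 2) × MSOType d (k + 2)) × MSOType d (k + 2) × MSOType d (k + 2))
      fun i j => (fun r => σ i r, pairType d Q (G i j) ∅ (P i), pairType d Q (G i j) (P i) (P i))
    have hcσ : ∀ i (r : Fin n), σ (f i) r = c.1 r := fun i r =>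
      congrFun (congrArg Prod.fst (hc i (i + 1) (Nat.lt_succ_self i))) r
    have hcG : ∀ i, (pairType d Q (G (f i) (f (i + 1))) ∅ (P (f i)),
        pairType d Q (G (f i) (f (i + 1))) (P (f i)) (P (f i))) = c.2 := fun i =>
      congrArg Prod.snd (hc i (i + 1) (Nat.lt_succ_self i))
    let F : ℕ → Ordinal.{0} → C := fun i => E (f i)
    have hF : ∀ i, StrictMonoOn (F i) (Set.Iio (ω ^ n)) := fun i => hE (f i)
    have hFF : ∀ i j, i < j → ∀ b < ω ^ n, ∀ c < ω ^ n, F i b < F j c := by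
      intro i j hij b hb c hc
      have h1 : E (f i) b < x (f i + 1) := (hES (f i) b hb).2.2
      have h2 : x (f j) ≤ E (f j) c := not_lt.1 (hES (f j) c hc).2.1
      have h3 : x (f i + 1) ≤ x (f j) := (strictMono_nat_of_lt_succ hx).monotone (hf hij)
      exact h1.trans_le (h3.trans h2)
    have hlimit : ∀ i, gapType d Q (concatSeq n F) (ω ^ n * (i + 1 : ℕ)) = c.2 := by
      intro i
      have hp := predPoint_concatSeq (E := F) (i := i) (omega0_pow_pos' n) le_rfl
      rw [← hcG i]
      have hg : gap (concatSeq n F) (ω ^ n * (i + 1 : ℕ)) = G (f i) (f (i + 1)) := by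
        ext z
        refine and_congr ?_ ?_
        · have := concatSeq_apply F (i + 1) (omega0_pow_pos' n)
          rw [add_zero] at this
          rw [this]
        · rw [omega0_pow_mul_succ]
          exact gap_concatSeq_iff hFF (omega0_pow_pos' n) le_rfl z
      rw [gapType, hg, omega0_pow_mul_succ, hp]
    have hinner : ∀ (i : ℕ) (b : Ordinal.{0}), 0 < b → b < ω ^ n →
        gapType d Q (concatSeq n F) (ω ^ n * i + b) = gapType d Q (F i) b := by
      intro i b hb0 hb
      have hp := predPoint_concatSeq (E := F) (i := i) hb0 hb.le
      have hg : gap (concatSeq n F) (ω ^ n * i + b) = gap (F i) b := by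
        ext z
        exact and_congr (by rw [concatSeq_apply F i hb]) (gap_concatSeq_iff hFF hb0 hb.le z)
      rw [gapType, hg, hp]
      rfl
    refine ⟨concatSeq n F, fun r => if hr : r < n then c.1 ⟨r, hr⟩ else c.2,
      concatSeq_strictMonoOn hF hFF, ?_, ?_⟩
    · intro β hβ
      obtain ⟨i, b, hb, rfl⟩ := exists_eq_omega0_pow_mul_add hβ
      rw [concatSeq_apply F i hb]
      exact (hES (f i) b hb).1
    · intro r hr α hα
      obtain ⟨i, a, ha, rfl⟩ := exists_eq_omega0_pow_mul_add (le_self_add.trans_lt hα)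
      by_cases hrn : r < n
      · have hlt := add_lt_omega0_pow ha (omega0_pow_lt hrn)
        rw [add_assoc, hinner i _ ((omega0_pow_pos' r).trans_le le_add_self) hlt, hσ (f i) r hrn a hlt]
        simp only [dif_pos hrn]
        exact hcσ i ⟨r, hrn⟩
      · obtain rfl : r = n := by omega
        rw [add_assoc, add_omega0_pow ha, ← omega0_pow_mul_succ, hlimit]
        simp only [dif_neg hrn]

end Ladders

/-! ### Shift invariance and the failure of ladder selection -/

section Ladders

variable {C : Type u} [LinearOrder C]

open Ordinal

/-- The interval is the ordered sum of its gaps at positions `0 < ζ < γ`. In a gap, subsets of the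
sequence can only contain the preceding point, so `gapType` covers every case and the composition
theorem applies. -/
theorem pairType_shift {d k : ℕ} {Q : Fin k → Set C} {e : Ordinal.{0} → C} {Ω : Ordinal.{0}}
    (he : StrictMonoOn e (Set.Iio Ω))
    (hgap : ∀ α ζ, 0 < ζ → α + ζ < Ω → gapType d Q e (α + ζ) = gapType d Q e ζ)
    {α α' γ : Ordinal.{0}} (hα : ∀ ζ < γ, α + ζ < Ω) (hα' : ∀ ζ < γ, α' + ζ < Ω) {X X' : Set C}
    (hX : X ⊆ e '' Set.Iio Ω) (hX' : X' ⊆ e '' Set.Iio Ω)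
    (hXX : ∀ ζ, ζ + 1 < γ → (e (α + ζ) ∈ X ↔ e (α' + ζ) ∈ X')) :
    pairType d Q {z | e α ≤ z ∧ ∃ ζ < γ, z < e (α + ζ)} X (e '' Set.Iio Ω) =
      pairType d Q {z | e α' ≤ z ∧ ∃ ζ < γ, z < e (α' + ζ)} X' (e '' Set.Iio Ω) := by
  classical
  have hle : ∀ {β δ}, β ≤ δ → δ < Ω → e β ≤ e δ := fun {β δ} h hδ =>
    he.monotoneOn (h.trans_lt hδ) hδ h
  have cover : ∀ α, (∀ ζ < γ, α + ζ < Ω) → {z | e α ≤ z ∧ ∃ ζ < γ, z < e (α + ζ)} =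
      ⋃ ζ, if 0 < ζ ∧ ζ < γ then gap e (α + ζ) else ∅ := by
    intro α hα
    ext z
    rw [Set.mem_iUnion]
    constructor
    · rintro ⟨h0, ζ, hζ, hz⟩
      have hne : {ζ | ζ < γ ∧ z < e (α + ζ)}.Nonempty := ⟨ζ, hζ, hz⟩
      have wf : WellFounded (· < · : Ordinal.{0} → Ordinal.{0} → Prop) := wellFounded_lt
      obtain ⟨h1, h2⟩ := wf.min_mem _ hne
      set ζ₀ := wf.min _ hne
      have h3 : 0 < ζ₀ := by
        rw [pos_iff_ne_zero]
        intro h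
        rw [h, add_zero] at h2
        exact absurd h2 (not_lt.2 h0)
      refine ⟨ζ₀, ?_⟩
      rw [if_pos ⟨h3, h1⟩]
      refine ⟨h2, fun β hβ => ?_⟩
      rcases le_total β α with h4 | h4
      · exact (hle h4 (by simpa using hα 0 (h3.trans h1))).trans h0
      · obtain ⟨ρ, rfl⟩ : ∃ ρ, β = α + ρ := ⟨_, (Ordinal.add_sub_cancel_of_le h4).symm⟩
        by_contra! h5
        have h6 : ρ < ζ₀ := (add_lt_add_iff_left _).1 hβ
        exact wf.not_lt_min {ζ | ζ < γ ∧ z < e (α + ζ)} ⟨h6.trans h1, h5⟩ h6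
    · rintro ⟨ζ, hz⟩
      split_ifs at hz with h
      · exact ⟨hz.2 α (lt_add_of_pos_right _ h.1), ζ, h.2, hz.1⟩
      · exact absurd hz (Set.notMem_empty z)
  have ordered : ∀ α, (∀ ζ < γ, α + ζ < Ω) → ∀ ζ ζ', ζ < ζ' →
      ∀ x ∈ (if 0 < ζ ∧ ζ < γ then gap e (α + ζ) else ∅),
      ∀ y ∈ (if 0 < ζ' ∧ ζ' < γ then gap e (α + ζ') else ∅), x < y := by
    intro α hα ζ ζ' hζ x hx y hy
    split_ifs at hx hy with h h'
    · exact hx.1.trans_le (hy.2 _ ((add_lt_add_iff_left _).2 hζ))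
    all_goals simp_all
  have inter : ∀ α, (∀ ζ < γ, α + ζ < Ω) → ∀ Z, Z ⊆ e '' Set.Iio Ω → ∀ ζ, 0 < ζ → ζ < γ →
      Z ∩ gap e (α + ζ) =
      (if ∃ ζ', ζ' + 1 = ζ ∧ e (α + ζ') ∈ Z then predPoint e (α + ζ) else ∅) ∩ gap e (α + ζ) := by
    intro α hα Z hZ ζ hζ0 hζ
    have hsub : Z ∩ gap e (α + ζ) ⊆ predPoint e (α + ζ) := by
      rintro z ⟨hz, hz1, hz2⟩
      obtain ⟨β, hβ, rfl⟩ := hZ hz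
      have hlt : β < α + ζ := (he.lt_iff_lt hβ (hα ζ hζ)).1 hz1
      refine ⟨β, le_antisymm (Order.add_one_le_iff.2 hlt) ?_, rfl⟩
      by_contra! h
      have h' : β + 1 < Ω := h.trans (hα ζ hζ)
      exact absurd (hz2 _ h) (not_le.2 (he hβ h' (Order.lt_add_one_iff.2 le_rfl)))
    have hpred : ∀ z ∈ predPoint e (α + ζ), ∃ ζ', ζ' + 1 = ζ ∧ z = e (α + ζ') := by
      rintro z ⟨β, hβ, rfl⟩
      have hαβ : α ≤ β := by
        rw [← Order.lt_add_one_iff, hβ]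
        exact lt_add_of_pos_right _ hζ0
      obtain ⟨ρ, rfl⟩ : ∃ ρ, β = α + ρ := ⟨_, (Ordinal.add_sub_cancel_of_le hαβ).symm⟩
      rw [add_assoc] at hβ
      exact ⟨ρ, (add_right_inj _).1 hβ, rfl⟩
    split_ifs with h
    · obtain ⟨ζ', rfl, hζ'⟩ := h
      apply Set.Subset.antisymm
      · exact fun z hz => ⟨hsub hz, hz.2⟩
      · rintro z ⟨hz, hz'⟩
        obtain ⟨ρ, hρ, rfl⟩ := hpred z hz
        have : ρ = ζ' := Order.succ_injective (by simpa [Order.succ_eq_add_one] using hρ)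
        subst this
        exact ⟨hζ', hz'⟩
    · rw [Set.empty_inter, Set.eq_empty_iff_forall_notMem]
      intro z hz
      obtain ⟨ρ, hρ, rfl⟩ := hpred z (hsub hz)
      exact h ⟨ρ, hρ, hz.1⟩
  have pieces : ∀ α, (∀ ζ < γ, α + ζ < Ω) → ∀ Z, Z ⊆ e '' Set.Iio Ω → ∀ ζ, 0 < ζ → ζ < γ →
      pairType d Q (gap e (α + ζ)) Z (e '' Set.Iio Ω) =
      if ∃ ζ', ζ' + 1 = ζ ∧ e (α + ζ') ∈ Z then (gapType d Q e ζ).2 else (gapType d Q e ζ).1 := by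
    intro α hα Z hZ ζ hζ0 hζ
    have hY : e '' Set.Iio Ω ∩ gap e (α + ζ) = predPoint e (α + ζ) ∩ gap e (α + ζ) := by
      rw [inter α hα _ subset_rfl ζ hζ0 hζ]
      split_ifs with h
      · rfl
      · rw [Set.empty_inter, eq_comm, Set.eq_empty_iff_forall_notMem]
        rintro _ ⟨⟨β, hβ, rfl⟩, -⟩
        have hαβ : α ≤ β := by
          rw [← Order.lt_add_one_iff, hβ]
          exact lt_add_of_pos_right _ hζ0
        obtain ⟨ρ, rfl⟩ : ∃ ρ, β = α + ρ := ⟨_, (Ordinal.add_sub_cancel_of_le hαβ).symm⟩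
        rw [add_assoc] at hβ
        refine h ⟨ρ, (add_right_inj _).1 hβ, α + ρ, ?_, rfl⟩
        refine lt_of_le_of_lt ?_ (hα ζ hζ)
        rw [← hβ, ← add_assoc]
        exact le_self_add
    rw [← hgap α ζ hζ0 (hα ζ hζ)]
    have hZ' := inter α hα Z hZ ζ hζ0 hζ
    rw [pairType_congr hZ' hY]
    split_ifs <;> rfl
  rw [cover α hα, cover α' hα']
  refine mtype_iUnion d (ordered α hα) (ordered α' hα') fun ζ => ?_
  split_ifs with h
  · refine (pieces α hα X hX ζ h.1 h.2).trans (Eq.trans ?_ (pieces α' hα' X' hX' ζ h.1 h.2).symm)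
    have : (∃ ζ', ζ' + 1 = ζ ∧ e (α + ζ') ∈ X) ↔ ∃ ζ', ζ' + 1 = ζ ∧ e (α' + ζ') ∈ X' :=
      exists_congr fun ζ' => and_congr_right fun h' => hXX ζ' (h' ▸ h.2)
    simp only [this]
  · exact pairType_congr (by simp) rfl

theorem pairType_block {d k : ℕ} {Q : Fin k → Set C} {e : Ordinal.{0} → C} {Ω : Ordinal.{0}}
    (he : StrictMonoOn e (Set.Iio Ω))
    (hgap : ∀ α ζ, 0 < ζ → α + ζ < Ω → gapType d Q e (α + ζ) = gapType d Q e ζ)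
    {α γ : Ordinal.{0}} (hα : α + γ < Ω) :
    pairType d Q (Set.Ico (e α) (e (α + γ))) {e α} (e '' Set.Iio Ω) =
      pairType d Q (Set.Ico (e 0) (e γ)) {e 0} (e '' Set.Iio Ω) := by
  have hlt : ∀ ζ < γ + 1, α + ζ < Ω := fun ζ hζ =>
    (add_le_add_right (Order.lt_add_one_iff.1 hζ) α).trans_lt hα
  have hlt' : ∀ ζ < γ + 1, 0 + ζ < Ω := fun ζ hζ => by
    rw [zero_add]; exact le_add_self.trans_lt (hlt ζ hζ)
  have hαΩ : α < Ω := le_self_add.trans_lt hα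
  have h0Ω : 0 < Ω := (zero_le (a := α)).trans_lt hαΩ
  have hset : ∀ α, (∀ ζ < γ + 1, α + ζ < Ω) →
      {z | e α ≤ z ∧ ∃ ζ < γ + 1, z < e (α + ζ)} = Set.Ico (e α) (e (α + γ)) := by
    intro α hlt
    have hγ : γ < γ + 1 := Order.lt_add_one_iff.2 le_rfl
    ext z
    refine and_congr_right fun _ => ⟨?_, fun h => ⟨γ, hγ, h⟩⟩
    rintro ⟨ζ, hζ, hz⟩
    exact hz.trans_le (he.monotoneOn (hlt ζ hζ) (hlt γ hγ)
      (add_le_add_right (Order.lt_add_one_iff.1 hζ) α))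
  have := pairType_shift (Q := Q) (d := d) he hgap hlt hlt' (X := {e α}) (X' := {e 0})
    (Set.singleton_subset_iff.2 ⟨α, hαΩ, rfl⟩) (Set.singleton_subset_iff.2 ⟨0, h0Ω, rfl⟩) (by
      intro ζ hζ
      have hζ' : ζ < γ + 1 := (Order.lt_add_one_iff.2 le_rfl).trans hζ
      rw [Set.mem_singleton_iff, Set.mem_singleton_iff, he.eq_iff_eq (hlt ζ hζ') hαΩ,
        he.eq_iff_eq (hlt' ζ hζ') h0Ω, zero_add]
      simp)
  rw [hset α hlt, hset 0 hlt', zero_add] at this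
  exact this

/-- No choice of ladders is invariant under monadic types of a fixed depth, in a chain containing
well ordered sets of order type `ω ^ n` for all `n`. -/
theorem exists_ladder_pairType_eq (hL : ∀ n, Large (fun x y : C => x < y) n Set.univ) (d : ℕ)
    {k : ℕ} (Q : Fin k → Set C) : ∃ Y : Set C, (∃ Z, IsLadder Z Y) ∧
      ∀ X, IsLadder X Y → ∃ X', X' ≠ X ∧
        pairType d Q Set.univ X Y = pairType d Q Set.univ X' Y := by
  -- One more power of `ω` than there are types: two blocks of lengths `ω ^ j` and `ω ^ l` below
  -- must share a type.
  let N := Nat.card (MSOType d (k + 2)) + 1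
  obtain ⟨e, σ, heN, -, hσ⟩ := exists_uniform_seq d Q N Set.univ (hL N)
  have hgapN : ∀ α ζ, 0 < ζ → α + ζ < ω ^ N → gapType d Q e (α + ζ) = gapType d Q e ζ := by
    intro α ζ hζ h
    obtain ⟨η, r, hr, rfl⟩ := exists_eq_add_omega0_pow hζ.ne' (le_add_self.trans_lt h)
    rw [hσ r hr η (le_add_self.trans_lt h), ← add_assoc]
    exact hσ r hr _ (by rwa [add_assoc])
  obtain ⟨j, l, hjl, hlN, hM⟩ : ∃ j l : ℕ, j < l ∧ l < N ∧
      pairType d Q (Set.Ico (e 0) (e (ω ^ j))) {e 0} (e '' Set.Iio (ω ^ N)) =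
      pairType d Q (Set.Ico (e 0) (e (ω ^ l))) {e 0} (e '' Set.Iio (ω ^ N)) := by
    have := Fintype.ofFinite (MSOType d (k + 2))
    obtain ⟨a, b, hab, h⟩ := Fintype.exists_ne_map_eq_of_card_lt (fun i : Fin N =>
      pairType d Q (Set.Ico (e 0) (e (ω ^ (i : ℕ)))) {e 0} (e '' Set.Iio (ω ^ N)))
      (by rw [Fintype.card_fin, ← Nat.card_eq_fintype_card]; exact Nat.lt_succ_self _)
    rcases lt_or_gt_of_ne hab with h' | h'
    · exact ⟨a, b, h', b.2, h⟩
    · exact ⟨b, a, h', a.2, h.symm⟩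
  have hΩN : (ω ^ (l + 1) : Ordinal.{0}) ≤ ω ^ N := pow_le_pow_right₀ one_lt_omega0.le hlN
  have he : StrictMonoOn e (Set.Iio (ω ^ (l + 1))) := heN.mono (Set.Iio_subset_Iio hΩN)
  have hgap : ∀ α ζ, 0 < ζ → α + ζ < ω ^ (l + 1) → gapType d Q e (α + ζ) = gapType d Q e ζ :=
    fun α ζ hζ h => hgapN α ζ hζ (h.trans_le hΩN)
  set Ω : Ordinal.{0} := ω ^ (l + 1) with hΩ
  have hlΩ : (ω ^ l : Ordinal.{0}) < Ω := omega0_pow_lt (Nat.lt_succ_self l)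
  have hjlt : (ω ^ j : Ordinal.{0}) < ω ^ l := omega0_pow_lt hjl
  have hpos : (0 : Ordinal.{0}) < Ω := omega0_pow_pos' _
  have hadd : ∀ {a b : Ordinal.{0}}, a < Ω → b < Ω → a + b < Ω := fun ha hb =>
    add_lt_omega0_pow ha hb
  have hM' : pairType d Q (Set.Ico (e 0) (e (ω ^ j))) {e 0} (e '' Set.Iio Ω) =
      pairType d Q (Set.Ico (e 0) (e (ω ^ l))) {e 0} (e '' Set.Iio Ω) := by
    have hY : ∀ β < Ω, e '' Set.Iio Ω ∩ Set.Ico (e 0) (e β) =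
        e '' Set.Iio (ω ^ N) ∩ Set.Ico (e 0) (e β) := by
      intro β hβ
      ext z
      refine and_congr_left fun hz => ⟨fun h => Set.image_mono (Set.Iio_subset_Iio hΩN) h, ?_⟩
      rintro ⟨δ, hδ, rfl⟩
      exact ⟨δ, ((heN.lt_iff_lt hδ (hβ.trans_le hΩN)).1 hz.2).trans hβ, rfl⟩
    rw [pairType_congr rfl (hY _ (hjlt.trans hlΩ)), pairType_congr rfl (hY _ hlΩ)]
    exact hM
  refine ⟨e '' Set.Iio Ω, ⟨Set.range fun n : ℕ => e (ω ^ l * n), ?_, ?_, ?_⟩, ?_⟩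
  · rintro _ ⟨n, rfl⟩
    exact ⟨_, omega0_pow_mul_lt l n, rfl⟩
  · rintro _ ⟨β, hβ, rfl⟩
    obtain ⟨i, b, hb, rfl⟩ := exists_eq_omega0_pow_mul_add hβ
    refine ⟨_, ⟨i + 1, rfl⟩, he hβ (omega0_pow_mul_lt l _) ?_⟩
    rw [omega0_pow_mul_succ]
    exact (add_lt_add_iff_left _).2 hb
  · rintro _ ⟨β, hβ, rfl⟩ ⟨_, ⟨n, rfl⟩, hn⟩
    classical
    have hn' : (ω ^ l * n : Ordinal.{0}) < β := (he.lt_iff_lt (omega0_pow_mul_lt l n) hβ).1 hn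
    obtain ⟨i, b, hb, rfl⟩ := exists_eq_omega0_pow_mul_add hβ
    have hex : ∃ m : ℕ, ω ^ l * i + b ≤ ω ^ l * (m : Ordinal.{0}) := ⟨i + 1, by
      rw [omega0_pow_mul_succ]
      exact add_le_add_right hb.le _⟩
    rcases hm : Nat.find hex with _ | m
    · have := Nat.find_spec hex
      rw [hm, Nat.cast_zero, mul_zero] at this
      exact absurd (hn'.trans_le this) not_lt_zero
    · have h1 := Nat.find_spec hex
      have h2 := not_le.1 (Nat.find_min hex (m := m) (by omega))
      rw [hm] at h1
      refine ⟨_, ⟨m, rfl⟩, he (omega0_pow_mul_lt l m) hβ h2, ?_⟩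
      rintro _ ⟨p, rfl⟩ ⟨h3, h4⟩
      have h3' := (he.lt_iff_lt (omega0_pow_mul_lt l m) (omega0_pow_mul_lt l p)).1 h3
      have h4' := (he.lt_iff_lt (omega0_pow_mul_lt l p) hβ).1 h4
      have h5 : m < p := by
        by_contra! hpm
        exact absurd h3' (not_lt.2 (mul_le_mul_right (Nat.cast_le.2 hpm) _))
      have h6 : (ω ^ l * (m + 1 : ℕ) : Ordinal.{0}) ≤ ω ^ l * p :=
        mul_le_mul_right (Nat.cast_le.2 h5) _
      exact absurd (h4'.trans_le (h1.trans h6)) (lt_irrefl _)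
  rintro X ⟨hXY, hcof, hpred⟩
  obtain ⟨_, hx₀, -⟩ := hcof _ ⟨0, hpos, rfl⟩
  obtain ⟨ξ₀, hξ₀, rfl⟩ := hXY hx₀
  set lam := ξ₀ + ω ^ l with hlam
  have hlamΩ : lam < Ω := hadd hξ₀ hlΩ
  have hξ₀lam : ξ₀ < lam := lt_add_of_pos_right _ (omega0_pow_pos' l)
  obtain ⟨_, hxX, hxlam, hmax⟩ := hpred _ ⟨lam, hlamΩ, rfl⟩ ⟨_, hx₀, he hξ₀ hlamΩ hξ₀lam⟩
  obtain ⟨ξ, hξ, rfl⟩ := hXY hxX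
  have hξlam : ξ < lam := (he.lt_iff_lt hξ hlamΩ).1 hxlam
  have hgapX : ∀ β, ξ < β → β < lam → e β ∉ X := fun β h1 h2 h3 =>
    hmax _ h3 ⟨he hξ (h2.trans hlamΩ) h1, he (h2.trans hlamΩ) hlamΩ h2⟩
  have hξ₀ξ : ξ₀ ≤ ξ := by
    by_contra! h
    exact hgapX ξ₀ h hξ₀lam hx₀
  -- `ξ` exceeds `ξ₀` by less than `ω ^ l`, which is absorbed; so the stretch after `ξ` that is free
  -- of `X` has length exactly `ω ^ l`.
  have hξl : ξ + ω ^ l = lam := by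
    obtain ⟨η, rfl⟩ : ∃ η, ξ = ξ₀ + η := ⟨_, (Ordinal.add_sub_cancel_of_le hξ₀ξ).symm⟩
    rw [add_assoc, add_omega0_pow ((add_lt_add_iff_left _).1 hξlam)]
  set mu := ξ + ω ^ j with hmu
  have hmulam : mu < lam := by
    rw [← hξl]; exact (add_lt_add_iff_left _).2 hjlt
  have hmuΩ : mu < Ω := hmulam.trans hlamΩ
  have hξmu : ξ < mu := lt_add_of_pos_right _ (omega0_pow_pos' j)
  -- `X` is kept up to `ξ`, and its part from `lam` on is moved down to `mu`: the block of length `ω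
  -- ^ l` after `ξ` shrinks to `ω ^ j`.
  let X' : Set C := {z | (z ∈ X ∧ z ≤ e ξ) ∨ ∃ ζ < Ω, e (lam + ζ) ∈ X ∧ z = e (mu + ζ)}
  have hX'Y : X' ⊆ e '' Set.Iio Ω := by
    rintro z (⟨hz, -⟩ | ⟨ζ, hζ, -, rfl⟩)
    · exact hXY hz
    · exact ⟨_, hadd hmuΩ hζ, rfl⟩
  have hmule : ∀ ζ < Ω, e mu ≤ e (mu + ζ) := fun ζ hζ =>
    he.monotoneOn hmuΩ (hadd hmuΩ hζ) le_self_add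
  have heξmu : e ξ < e mu := he hξ hmuΩ hξmu
  have hshift : ∀ ζ < Ω, (e (mu + ζ) ∈ X' ↔ e (lam + ζ) ∈ X) := by
    intro ζ hζ
    constructor
    · rintro (⟨-, h⟩ | ⟨ζ', hζ', h, h'⟩)
      · exact absurd h (not_le.2 (heξmu.trans_le (hmule ζ hζ)))
      · rw [he.eq_iff_eq (hadd hmuΩ hζ) (hadd hmuΩ hζ'), add_right_inj] at h'
        rwa [h']
    · exact fun h => Or.inr ⟨ζ, hζ, h, rfl⟩
  refine ⟨X', ?_, ?_⟩
  · intro hEq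
    obtain ⟨_, hyX, hy⟩ := hcof _ ⟨lam, hlamΩ, rfl⟩
    obtain ⟨β₀, hβ₀, rfl⟩ := hXY hyX
    -- For the first position `lam + ζ` of `X` from `lam` on, `X' = X` would put `mu + ζ` in `X`.
    -- This position is smaller by `omega0_pow_add_lt`, yet not in the free stretch below `lam`.
    have hne : {β | lam ≤ β ∧ β < Ω ∧ e β ∈ X}.Nonempty :=
      ⟨β₀, ((he.lt_iff_lt hlamΩ hβ₀).1 hy).le, hβ₀, hyX⟩
    have wf : WellFounded (· < · : Ordinal.{0} → Ordinal.{0} → Prop) := wellFounded_lt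
    obtain ⟨h1, h2, h3⟩ := wf.min_mem _ hne
    have hmin : ∀ β, lam ≤ β → β < Ω → e β ∈ X → wf.min _ hne ≤ β := fun β a b c =>
      not_lt.1 (wf.not_lt_min {β | lam ≤ β ∧ β < Ω ∧ e β ∈ X} ⟨a, b, c⟩)
    set β := wf.min _ hne
    obtain ⟨ζ, hζ⟩ : ∃ ζ, β = lam + ζ := ⟨_, (Ordinal.add_sub_cancel_of_le h1).symm⟩
    have hζΩ : ζ < Ω := le_add_self.trans_lt (hζ ▸ h2)
    have h4 : e (mu + ζ) ∈ X := by
      rw [← hEq, hshift ζ hζΩ, ← hζ]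
      exact h3
    rcases lt_or_ge (mu + ζ) lam with h5 | h5
    · exact hgapX _ (hξmu.trans_le le_self_add) h5 h4
    · have h6 := hmin _ h5 (hadd hmuΩ hζΩ) h4
      rw [hζ, ← hξl, hmu, add_assoc, add_assoc, add_le_add_iff_left] at h6
      exact absurd (omega0_pow_add_lt hjl hζΩ) (not_lt.2 h6)
  -- The two cuts differ only in the second and third pieces: the second have equal types by the
  -- choice of `j` and `l`, the third by shift invariance.
  · let U : Ordinal.{0} → Fin 4 → Set C := fun ν => ![Set.Iio (e ξ), Set.Ico (e ξ) (e ν),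
      {z | e ν ≤ z ∧ ∃ ζ < Ω, z < e (ν + ζ)}, {z | ∀ β < Ω, e β ≤ z}]
    have hU : ∀ ν, ξ < ν → ν < Ω → ⋃ p, U ν p = Set.univ := by
      intro ν hν hνΩ
      rw [Set.eq_univ_iff_forall]
      intro z
      rw [Set.mem_iUnion]
      rcases lt_or_ge z (e ξ) with h0 | h0
      · exact ⟨0, h0⟩
      rcases lt_or_ge z (e ν) with h1 | h1
      · exact ⟨1, h0, h1⟩
      by_cases h2 : ∃ ζ < Ω, z < e (ν + ζ)
      · exact ⟨2, h1, h2⟩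
      · push Not at h2
        exact ⟨3, fun β hβ => (he.monotoneOn hβ (hadd hνΩ hβ) le_add_self).trans (h2 β hβ)⟩
    have hUlt : ∀ ν, ξ < ν → ν < Ω → ∀ p q, p < q → ∀ x ∈ U ν p, ∀ y ∈ U ν q, x < y := by
      intro ν hν hνΩ p q hpq x hx y hy
      have hlt := he hξ hνΩ hν
      have upper : ∀ p, p < 3 → ∀ x ∈ U ν p, ∃ β < Ω, x < e β := by
        intro p hp x hx
        fin_cases p
        · exact ⟨ξ, hξ, hx⟩
        · exact ⟨ν, hνΩ, hx.2⟩
        · obtain ⟨-, ζ, hζ, h⟩ := hx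
          exact ⟨ν + ζ, hadd hνΩ hζ, h⟩
        · exact absurd hp (lt_irrefl _)
      fin_cases q
      · exact absurd hpq (Fin.not_lt_zero p)
      · fin_cases p
        · exact lt_of_lt_of_le hx hy.1
        all_goals exact absurd hpq (by decide)
      · fin_cases p
        · exact (lt_trans hx hlt).trans_le hy.1
        · exact lt_of_lt_of_le hx.2 hy.1
        all_goals exact absurd hpq (by decide)
      · obtain ⟨β, hβ, h⟩ := upper p hpq x hx
        exact h.trans_le (hy β hβ)
    have huniv : pairType d Q (⋃ p, U lam p) X (e '' Set.Iio Ω) =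
        pairType d Q (⋃ p, U mu p) X' (e '' Set.Iio Ω) := by
      refine mtype_iUnion d (hUlt lam hξlam hlamΩ) (hUlt mu hξmu hmuΩ) fun p => ?_
      fin_cases p
      · refine pairType_congr ?_ rfl
        ext z
        refine and_congr_left fun hz => ?_
        constructor
        · exact fun h => Or.inl ⟨h, le_of_lt hz⟩
        · rintro (h | ⟨ζ, hζ, -, rfl⟩)
          · exact h.1
          · exact absurd (lt_trans hz heξmu) (not_lt.2 (hmule ζ hζ))
      · have hX1 : X ∩ Set.Ico (e ξ) (e lam) = {e ξ} ∩ Set.Ico (e ξ) (e lam) := by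
          ext z
          refine and_congr_left fun hz => ⟨fun h => ?_, fun h => ?_⟩
          · obtain ⟨β, hβ, rfl⟩ := hXY h
            rcases (((he.le_iff_le hξ hβ).1 hz.1).lt_or_eq) with h' | rfl
            · exact absurd h (hgapX β h' ((he.lt_iff_lt hβ hlamΩ).1 hz.2))
            · rfl
          · obtain rfl : z = e ξ := h
            exact hxX
        have hX2 : X' ∩ Set.Ico (e ξ) (e mu) = {e ξ} ∩ Set.Ico (e ξ) (e mu) := by
          ext z
          refine and_congr_left fun hz => ⟨fun h => ?_, fun h => ?_⟩
          · rcases h with h | ⟨ζ, hζ, -, rfl⟩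
            · exact le_antisymm h.2 hz.1
            · exact absurd hz.2 (not_lt.2 (hmule ζ hζ))
          · obtain rfl : z = e ξ := h
            exact Or.inl ⟨hxX, le_rfl⟩
        refine (pairType_congr hX1 rfl).trans (Eq.trans ?_ (pairType_congr hX2 rfl).symm)
        have b1 := pairType_block (Q := Q) (d := d) he hgap (α := ξ) (γ := ω ^ l)
          (by rw [hξl]; exact hlamΩ)
        have b2 := pairType_block (Q := Q) (d := d) he hgap (α := ξ) (γ := ω ^ j) hmuΩ
        rw [hξl] at b1
        exact b1.trans (hM'.symm.trans b2.symm)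
      · refine pairType_shift he hgap (fun ζ hζ => hadd hlamΩ hζ) (fun ζ hζ => hadd hmuΩ hζ) hXY
          hX'Y fun ζ hζ => ?_
        exact (hshift ζ ((Order.lt_add_one_iff.2 le_rfl).trans hζ)).symm
      · have htop : ∀ Z, Z ⊆ e '' Set.Iio Ω → Z ∩ {z | ∀ β < Ω, e β ≤ z} = ∅ := by
          intro Z hZ
          rw [Set.eq_empty_iff_forall_notMem]
          rintro z ⟨hz, hz'⟩
          obtain ⟨β, hβ, rfl⟩ := hZ hz
          have hβ1 : β + 1 < Ω := hadd hβ ((one_lt_omega0).trans_le (by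
            rw [hΩ]; exact le_self_pow one_lt_omega0.le (Nat.succ_ne_zero l)))
          exact absurd (hz' _ hβ1) (not_le.2 (he hβ hβ1 (Order.lt_add_one_iff.2 le_rfl)))
        exact pairType_congr ((htop X hXY).trans (htop X' hX'Y).symm) rfl
    rwa [hU lam hξlam hlamΩ, hU mu hξmu hmuΩ] at huniv

end Ladders

/-! ### Conclusion -/

section Main

variable {C : Type u} [LinearOrder C]

/-- Lets the ladder argument, which concerns ascending copies of `ω ^ n`, bound the descending ones
as well. -/
theorem HasUniformizationProperty.dual (hU : HasUniformizationProperty C) :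
    HasUniformizationProperty Cᵒᵈ := by
  intro m φ P h
  obtain ⟨k, ψ, Q, h1, h2⟩ := hU m φ.flip P fun Y =>
    (h Y).imp fun X hX => (φ.holds_flip' (C := C) _).2 hX
  have hψ : ∀ X Y : Set C, ψ.flip.HoldsAt (C := Cᵒᵈ) Q X Y ↔ ψ.HoldsAt Q X Y := fun X Y =>
    ψ.holds_flip (C := C) _
  refine ⟨k, ψ.flip, Q, fun Y => ?_, fun X Y hX => ?_⟩
  · obtain ⟨X, hX, huniq⟩ := h1 Y
    exact ⟨X, (hψ X Y).2 hX, fun Z hZ => huniq Z ((hψ Z Y).1 hZ)⟩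
  · exact (φ.holds_flip' (C := C) _).1 (h2 X Y ((hψ X Y).1 hX))

theorem HasUniformizationProperty.exists_not_large (hU : HasUniformizationProperty C) :
    ∃ n, ¬ Large (fun x y : C => x < y) n Set.univ := by
  by_contra! hL
  -- The implication makes the formula satisfiable for every `Y`, including those without a ladder.
  let φ : MSOFormula 2 := ((MSOFormula.ladder (Fin.last 2) 1).ex.and (MSOFormula.ladder 0 1).neg).neg
  have hφ : ∀ X Y : Set C, MSOFormula.HoldsAt (m := 0) φ Fin.elim0 X Y ↔
      ((∃ Z, IsLadder Z Y) → IsLadder X Y) := by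
    intro X Y
    have h1 : MSOFormula.HoldsAt (m := 0) φ Fin.elim0 X Y ↔
        ¬ ((∃ Z, IsLadder Z Y) ∧ ¬ IsLadder X Y) := by
      refine not_congr (and_congr (exists_congr fun Z => ?_) (not_congr ?_))
      · exact MSOFormula.holds_ladder _ _ _
      · exact MSOFormula.holds_ladder _ _ _
    rw [h1]
    tauto
  obtain ⟨k, ψ, Q, hψ, hψφ⟩ := hU 0 φ Fin.elim0 fun Y => by
    by_cases h : ∃ Z, IsLadder Z Y
    · exact h.imp fun Z hZ => (hφ Z Y).2 fun _ => hZ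
    · exact ⟨∅, (hφ ∅ Y).2 fun h' => absurd h' h⟩
  obtain ⟨d, hd⟩ := ψ.exists_depth (C := C)
  obtain ⟨Y, hY, hX⟩ := exists_ladder_pairType_eq hL d Q
  obtain ⟨X, hXY, huniq⟩ := hψ Y
  obtain ⟨X', hne, htype⟩ := hX X ((hφ X Y).1 (hψφ X Y hXY) hY)
  exact hne (huniq X' ((hd d le_rfl _ _ htype).1 hXY))

open Ordinal in
theorem countable_of_type_lt {C : Type u} {r : C → C → Prop} [IsWellOrder C r] {n : ℕ}
    (h : Ordinal.type r < ω ^ n) : Countable C := by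
  rw [← Cardinal.mk_le_aleph0_iff, ← Ordinal.card_type r]
  refine (Ordinal.card_le_card h.le).trans ?_
  rw [← opow_natCast]
  refine (card_opow_le _ _).trans ?_
  simp

end Main

open Ordinal in
theorem theorem5p3 (C : Type u) [LinearOrder C] [Nonempty C] (hC : IsTameChain C)
    (hU : HasUniformizationProperty C) :
    (∃ k : ℕ, ∀ l : ℕ∞, IsLog C l ↔ l = (k : ℕ∞)) ∧
      ¬ ∃ α : Ordinal.{u}, HasDefinableWellOrder C α ∧
        Ordinal.omega0 ^ Ordinal.omega0 ≤ α := by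
  obtain ⟨hscat, n, hn⟩ := hC
  obtain ⟨k₁, hk₁⟩ := hU.exists_not_large
  obtain ⟨k₂, hk₂⟩ := hU.dual.exists_not_large
  obtain ⟨c, d, hwo, hlarge⟩ := exists_layered_isWellOrder n C hn
  set R := layered c d n
  have hR : IsDefinableRel R := isDefinableRel_layered c d n
  have hbound : ¬ Large R (n * max k₁ k₂ + 1) Set.univ := fun h =>
    (hlarge _ h).elim (fun h => hk₁ (h.of_le (le_max_left _ _)))
      fun h => hk₂ (h.of_le (le_max_right _ _))
  have : Countable C := countable_of_type_lt (not_le.1 fun h => hbound (large_iff_le_type.2 h))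
  -- Every definable well-ordering is compared with `R`, in both directions.
  have hdef : ∀ α : Ordinal.{u}, HasDefinableWellOrder C α → ∀ k : ℕ,
      ω ^ k ≤ α ↔ Large R k Set.univ := by
    rintro _ ⟨m, φ, P, hw, rfl⟩ k
    have hφ : IsDefinableRel (φ.Rel P) := ⟨m, φ, P, fun _ _ => Iff.rfl⟩
    rw [← large_iff_le_type]
    exact ⟨large_univ_of_definable hscat hφ hR, large_univ_of_definable hscat hR hφ⟩
  have hno : ¬ ∃ α : Ordinal.{u}, HasDefinableWellOrder C α ∧ ω ^ ω ≤ α := by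
    rintro ⟨α, hα, h⟩
    refine hbound ((hdef α hα _).1 (le_trans ?_ h))
    rw [← opow_natCast]
    exact opow_le_opow_right omega0_pos (natCast_lt_omega0 _).le
  classical
  obtain ⟨α, hα⟩ : ∃ α, HasDefinableWellOrder C α := by
    obtain ⟨m, φ, P, h⟩ := hR
    have hRel : φ.Rel P = R := funext₂ fun x y => propext (h x y)
    exact ⟨_, m, φ, P, hRel ▸ hwo, rfl⟩
  have hex : ∃ k, ¬ Large R k Set.univ := ⟨_, hbound⟩
  obtain ⟨k, hk⟩ : ∃ k, Nat.find hex = k + 1 := by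
    refine Nat.exists_eq_succ_of_ne_zero fun h => ?_
    exact (h ▸ Nat.find_spec hex) Set.univ_nonempty
  have hk1 : Large R k Set.univ := not_not.1 (Nat.find_min hex (m := k) (by omega))
  have hk2 : ¬ Large R (k + 1) Set.univ := hk ▸ Nat.find_spec hex
  refine ⟨⟨k, fun l => ⟨?_, ?_⟩⟩, hno⟩
  · rintro (⟨-, h⟩ | ⟨j, rfl, β, hβ, h1, h2⟩)
    · exact absurd h hno
    · have h3 := (hdef β hβ j).1 h1
      have h4 : ¬ Large R (j + 1) Set.univ := fun h => absurd ((hdef β hβ _).2 h) (not_le.2 h2)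
      have h5 : j = k := by
        rcases lt_trichotomy j k with h | h | h
        · exact absurd (hk1.of_le h) h4
        · exact h
        · exact absurd (h3.of_le h) hk2
      rw [h5]
  · rintro rfl
    exact Or.inr ⟨k, rfl, α, hα, (hdef α hα k).2 hk1,
      not_le.1 fun h => hk2 ((hdef α hα _).1 h)⟩
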